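/- Let $(M,g)$ be a spacetime, i.e. a smooth (Hausdorff) 4-manifold with a smooth pseudo-Riemannian metric $g=\langle\cdot,\cdot\rangle$ of signature $(-,+,+,+)$. Let $R(X,Y)Z=\nabla_X\nabla_YZ-\nabla_Y\nabla_XZ-\nabla_{[X,Y]}Z$ be the curvature of the Levi-Civita connection, $\mathrm{Ric}(X,X)=\mathrm{Tr}\,(Y\mapsto R(Y,X)X)$ the Ricci tensor, $R=g^{ij}R_{ij}$ the scalar curvature and $G=\mathrm{Ric}-\tfrac12 R\,g$. Let $\kappa$ be a real constant and $\mathcal E$ a twice covariant tensor field on $M$ (the energy-momentum tensor) such that the field equations $G=8\pi\kappa\,\mathcal E$ hold on $M$. Let $S\subset M$ be an embedded smooth hypersurface on which the induced metric is nondegenerate, and let $R^S$ be the scalar curvature of the induced metric. Suppose that $S$ is totally geodesic, i.e. every geodesic of $S$ is a geodesic of $M$. 1. At every point of $S$ and for every unit normal vector $N$ of $S$ there, with $\epsilon_N=\langle N,N\rangle\in\{-1,1\}$, $$R^S=-16\,\epsilon_N\,\pi\kappa\,\mathcal E(N,N).$$ 2. Suppose moreover that $\mathcal E$ is the energy-momentum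 tensor of a perfect fluid, i.e. $\mathcal E=(\rho_0+\tfrac{p}{c^2})\,U^\flat\otimes U^\flat+\tfrac{p}{c^2}\,g$, where $c>0$ is the speed of light, $\rho_0$ and $p$ are real functions on $M$ (proper density and pressure), $U$ is a vector field with $\langle U,U\rangle=-1$ and $U^\flat=\langle U,\cdot\rangle$, and that $S$ is spacelike, i.e. its nonzero normal vectors are timelike. Then at every point of $S$ and for every unit normal vector $N$ of $S$ there, $$R^S=16\,\pi\kappa\,\mathcal E(N,N).$$ -/

import Mathlib

open scoped Manifold ContDiff

noncomputable section

namespace Spacetime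

/-- A field of bilinear forms (a twice covariant tensor field) on the `n`-manifold `M`. -/
abbrev BilinField (n : ℕ) (M : Type*) [TopologicalSpace M]
    [ChartedSpace (EuclideanSpace ℝ (Fin n)) M] : Type _ :=
  ∀ x : M, LinearMap.BilinForm ℝ (TangentSpace (𝓡 n) x)

section Coordinates

variable {n : ℕ} {M : Type*} [TopologicalSpace M] [ChartedSpace (EuclideanSpace ℝ (Fin n)) M]

/-- The coordinate vector `∂/∂xⁱ` of the chart `φ`, at the point with coordinates `y`. -/
def coordVec (φ : OpenPartialHomeomorph M (EuclideanSpace ℝ (Fin n)))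
    (y : EuclideanSpace ℝ (Fin n)) (i : Fin n) : TangentSpace (𝓡 n) (φ.symm y) :=
  mfderiv (𝓡 n) (𝓡 n) φ.symm y (EuclideanSpace.single i (1 : ℝ))

/-- The matrix `g_{ij} = g(∂/∂xⁱ, ∂/∂xʲ)` of `g` in the chart `φ`, at coordinates `y`. -/
def components (g : BilinField n M) (φ : OpenPartialHomeomorph M (EuclideanSpace ℝ (Fin n)))
    (y : EuclideanSpace ℝ (Fin n)) : Matrix (Fin n) (Fin n) ℝ :=
  Matrix.of fun i j => g (φ.symm y) (coordVec φ y i) (coordVec φ y j)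

/-- The partial derivative `∂F/∂xᵏ` at `y`. -/
def partialDeriv (F : EuclideanSpace ℝ (Fin n) → ℝ) (k : Fin n)
    (y : EuclideanSpace ℝ (Fin n)) : ℝ :=
  fderiv ℝ F y (EuclideanSpace.single k (1 : ℝ))

/-- The Christoffel symbols `Γˡ_{ij} = ½ gˡᵐ (∂_j g_{im} + ∂_i g_{mj} - ∂_m g_{ij})` of the
Levi-Civita connection of `g` in the chart `φ`, so that `∇_{∂_i} ∂_j = Γˡ_{ij} ∂_l`. -/
def christoffel (g : BilinField n M) (φ : OpenPartialHomeomorph M (EuclideanSpace ℝ (Fin n)))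
    (l i j : Fin n) (y : EuclideanSpace ℝ (Fin n)) : ℝ :=
  (1 / 2 : ℝ) * ∑ m, (components g φ y)⁻¹ l m *
    (partialDeriv (fun z => components g φ z i m) j y
      + partialDeriv (fun z => components g φ z m j) i y
      - partialDeriv (fun z => components g φ z i j) m y)

/-- The components `Rˡ_{kij}` of the curvature tensor
`R(X, Y)Z = ∇_X ∇_Y Z - ∇_Y ∇_X Z - ∇_{[X, Y]} Z`, so that `R(∂_i, ∂_j)∂_k = Rˡ_{kij} ∂_l`. -/
def curvature (g : BilinField n M) (φ : OpenPartialHomeomorph M (EuclideanSpace ℝ (Fin n)))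
    (l k i j : Fin n) (y : EuclideanSpace ℝ (Fin n)) : ℝ :=
  partialDeriv (christoffel g φ l j k) i y - partialDeriv (christoffel g φ l i k) j y
    + ∑ r, (christoffel g φ r j k y * christoffel g φ l i r y
      - christoffel g φ r i k y * christoffel g φ l j r y)

/-- The components `R_{kj} = Rˢ_{ksj}` of the Ricci tensor in the chart `φ`. -/
def ricciComponents (g : BilinField n M)
    (φ : OpenPartialHomeomorph M (EuclideanSpace ℝ (Fin n)))
    (k j : Fin n) (y : EuclideanSpace ℝ (Fin n)) : ℝ :=
  ∑ s, curvature g φ s k s j y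

/-- The Ricci tensor `Ric(X, Y) = R_{ij} Xⁱ Yʲ` at `x`, computed in the preferred chart at `x`. -/
def ricci (g : BilinField n M) (x : M) (X Y : TangentSpace (𝓡 n) x) : ℝ :=
  let φ := chartAt (EuclideanSpace ℝ (Fin n)) x
  let X' : EuclideanSpace ℝ (Fin n) := mfderiv (𝓡 n) (𝓡 n) φ x X
  let Y' : EuclideanSpace ℝ (Fin n) := mfderiv (𝓡 n) (𝓡 n) φ x Y
  ∑ i, ∑ j, ricciComponents g φ i j (φ x) * X' i * Y' j

/-- The scalar curvature `R = gⁱʲ R_{ij}` at `x`, computed in the preferred chart at `x`. -/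
def scalarCurvature (g : BilinField n M) (x : M) : ℝ :=
  let φ := chartAt (EuclideanSpace ℝ (Fin n)) x
  ∑ i, ∑ j, (components g φ (φ x))⁻¹ i j * ricciComponents g φ i j (φ x)

/-- The Hilbert–Einstein–Cartan tensor `G = Ric - ½ R g`. -/
def einsteinTensor (g : BilinField n M) (x : M) (X Y : TangentSpace (𝓡 n) x) : ℝ :=
  ricci g x X Y - (1 / 2 : ℝ) * scalarCurvature g x * g x X Y

/-- The `C²` curve `γ` is a geodesic of `g` on the open interval `(a, b)`: in every chart it
satisfies `ẍⁱ + Γⁱ_{jk} ẋʲ ẋᵏ = 0`. -/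
def IsGeodesic (g : BilinField n M) (γ : ℝ → M) (a b : ℝ) : Prop :=
  ContMDiffOn 𝓘(ℝ, ℝ) (𝓡 n) 2 γ (Set.Ioo a b) ∧
  ∀ t ∈ Set.Ioo a b, ∀ φ ∈ atlas (EuclideanSpace ℝ (Fin n)) M, γ t ∈ φ.source →
    ∀ i : Fin n,
      deriv (deriv fun s => φ (γ s)) t i
        + ∑ j, ∑ k, christoffel g φ i j k (φ (γ t))
            * deriv (fun s => φ (γ s)) t j * deriv (fun s => φ (γ s)) t k = 0

end Coordinates

section Spacetimes

variable {M : Type*} [TopologicalSpace M] [ChartedSpace (EuclideanSpace ℝ (Fin 4)) M]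

/-- `g` is a smooth pseudo-Riemannian metric of signature `(-, +, +, +)` on the 4-manifold `M`. -/
structure IsLorentzMetric (g : BilinField 4 M) : Prop where
  smooth : ∀ φ ∈ atlas (EuclideanSpace ℝ (Fin 4)) M, ∀ i j : Fin 4,
    ContDiffOn ℝ ∞ (fun y => components g φ y i j) φ.target
  symm : ∀ (x : M) (X Y : TangentSpace (𝓡 4) x), g x X Y = g x Y X
  signature : ∀ x : M, ∃ e : Module.Basis (Fin 4) ℝ (TangentSpace (𝓡 4) x), ∀ i j : Fin 4,
    g x (e i) (e j) = if i = j then (if i = 0 then -1 else 1) else 0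

/-- The field equations `Ric - ½ R g = 8πκ 𝓔`. -/
def EinsteinFieldEquations (g : BilinField 4 M) (κ : ℝ) (𝓔 : BilinField 4 M) : Prop :=
  ∀ (x : M) (X Y : TangentSpace (𝓡 4) x),
    einsteinTensor g x X Y = 8 * Real.pi * κ * 𝓔 x X Y

/-- `𝓔` is the energy-momentum tensor `(ρ + p/c²) U ⊗ U + (p/c²) g` (in covariant form) of a
perfect fluid with proper mass density `ρ`, pressure `p` and unit timelike four-velocity `U`. -/
def IsPerfectFluid (g : BilinField 4 M) (c : ℝ) (𝓔 : BilinField 4 M) : Prop :=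
  ∃ (ρ p : M → ℝ) (U : ∀ x : M, TangentSpace (𝓡 4) x),
    (∀ x, g x (U x) (U x) = -1) ∧
    ∀ (x : M) (X Y : TangentSpace (𝓡 4) x),
      𝓔 x X Y = (ρ x + p x / c ^ 2) * (g x (U x) X * g x (U x) Y) + p x / c ^ 2 * g x X Y

variable {S : Type*} [TopologicalSpace S] [ChartedSpace (EuclideanSpace ℝ (Fin 3)) S]

/-- The first fundamental form of the hypersurface `ι : S → M`. -/
def induced (g : BilinField 4 M) (ι : S → M) : BilinField 3 S := fun s =>
  (g (ι s)).comp (mfderiv (𝓡 3) (𝓡 4) ι s).toLinearMap (mfderiv (𝓡 3) (𝓡 4) ι s).toLinearMap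

/-- `S` inherits a pseudo-Riemannian structure: the induced form is nondegenerate. -/
def InducedNondegenerate (g : BilinField 4 M) (ι : S → M) : Prop :=
  ∀ (s : S) (v : TangentSpace (𝓡 3) s),
    (∀ w : TangentSpace (𝓡 3) s, induced g ι s v w = 0) → v = 0

/-- Every geodesic of `S` is a geodesic of `M`. -/
def IsTotallyGeodesic (g : BilinField 4 M) (ι : S → M) : Prop :=
  ∀ (γ : ℝ → S) (a b : ℝ), IsGeodesic (induced g ι) γ a b → IsGeodesic g (ι ∘ γ) a b

/-- `N` is normal to `S` at `s`. -/
def IsNormal (g : BilinField 4 M) (ι : S → M) (s : S) (N : TangentSpace (𝓡 4) (ι s)) : Prop :=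
  ∀ v : TangentSpace (𝓡 3) s, g (ι s) N (mfderiv (𝓡 3) (𝓡 4) ι s v) = 0

/-- `N` is a unit normal of `S` at `s`: it is normal and `⟨N, N⟩ = ±1`. -/
def IsUnitNormal (g : BilinField 4 M) (ι : S → M) (s : S)
    (N : TangentSpace (𝓡 4) (ι s)) : Prop :=
  IsNormal g ι s N ∧ (g (ι s) N N = 1 ∨ g (ι s) N N = -1)

/-- `S` is spacelike: its nonzero normal vectors are timelike. -/
def IsSpacelike (g : BilinField 4 M) (ι : S → M) : Prop :=
  ∀ (s : S) (N : TangentSpace (𝓡 4) (ι s)), IsNormal g ι s N → N ≠ 0 → g (ι s) N N < 0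

end Spacetimes

end Spacetime

end

/-!
For spacelike `S` the unit normal has `⟨N, N⟩ = -1`, so the formula for a perfect fluid is a special
case of the general one. That one follows from the Gauss equation: for a totally geodesic
hypersurface `S` with unit normal `N` and `ε = ⟨N, N⟩`, the scalar curvatures satisfy
`R = R^S + 2 ε Ric(N, N)` (`scalarCurvature_totallyGeodesic`), and since `ε² = 1` this is
`R^S = -2 ε (Ric - ½ R g)(N, N)`, to which the field equations apply.

Everything is computed in charts, where the metric and the Christoffel symbols become fields `G` and
`Γ` of bilinear maps on an open subset of `ℝⁿ`, related by the Koszul formula (`IsLeviCivitaOn`).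
If a map `f` pulls `G` back to a metric with connection `γ`, then its Hessian
`∇df = D²f + Γ(Df, Df) - Df γ` is normal to the image of `Df` (`metric_hessianForm`). For changes of
coordinates, this is the transformation law of the Christoffel symbols (`hessianForm_transition`).

Total geodesy is a statement about geodesics. Through every point of `S` and in every direction
there is a geodesic (`exists_geodesic_ode`), first in one chart and then, by the transformation law,
in all of them (`isGeodesic_of_ode`). Its image being a geodesic of `M` says that the Hessian of the
embedding vanishes on the diagonal, hence identically (`hessianForm_eq_zero_of_geodesics`).
Differentiating `∇df = 0` shows that `Df` carries the curvature of `S` to that of `M`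
(`curvatureForm_map`). The formula for `R` follows by taking traces in a frame adapted to `S`
(`scalarForm_hypersurface`), where the mixed terms are identified with `Ric(N, N)` by the
skew-symmetries of the curvature (`metric_curvatureForm`, `curvatureForm_swap`).
-/

noncomputable section
set_option maxSynthPendingDepth 3
namespace Spacetime

/-! ### Levi-Civita connections on open sets of a normed space -/

section Calculus

variable {E F : Type*} [NormedAddCommGroup E] [NormedSpace ℝ E]
  [NormedAddCommGroup F] [NormedSpace ℝ F]

/-- On the open set `U`, `G` is a smooth nondegenerate symmetric metric and `Γ` is its Levi-Civita
connection, `∇_u v = D_u v + Γ(u, v)` for vector fields on `U`. The connection is pinned down by the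
Koszul formula, from which its symmetry and its compatibility with `G` follow. -/
structure IsLeviCivitaOn (U : Set E) (G : E → E →L[ℝ] E →L[ℝ] ℝ) (Γ : E → E →L[ℝ] E →L[ℝ] E) :
    Prop where
  isOpen : IsOpen U
  metric_contDiffOn : ContDiffOn ℝ ∞ G U
  contDiffOn : ContDiffOn ℝ ∞ Γ U
  metric_symm : ∀ x ∈ U, ∀ u v, G x u v = G x v u
  nondegenerate : ∀ x ∈ U, ∀ u, (∀ v, G x u v = 0) → u = 0
  koszul : ∀ x ∈ U, ∀ u v w, G x (Γ x u v) w =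
    1 / 2 * (fderiv ℝ G x v u w + fderiv ℝ G x u w v - fderiv ℝ G x w u v)

/-- The curvature `R(u, v) w` at `x` of the connection `∇_u w = D_u w + Γ(u, w)`, for constant
vector fields `u`, `v`, `w`. -/
def curvatureForm (Γ : E → E →L[ℝ] E →L[ℝ] E) (x u v w : E) : E :=
  fderiv ℝ Γ x u v w - fderiv ℝ Γ x v u w + (Γ x u (Γ x v w) - Γ x v (Γ x u w))

theorem curvatureForm_swap (Γ : E → E →L[ℝ] E →L[ℝ] E) (x u v w : E) :
    curvatureForm Γ x u v w = - curvatureForm Γ x v u w := by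
  simp only [curvatureForm]; abel

namespace IsLeviCivitaOn

variable {U : Set E} {G : E → E →L[ℝ] E →L[ℝ] ℝ} {Γ : E → E →L[ℝ] E →L[ℝ] E}

theorem metric_differentiableAt (h : IsLeviCivitaOn U G Γ) {x : E} (hx : x ∈ U) :
    DifferentiableAt ℝ G x :=
  (h.metric_contDiffOn.contDiffAt (h.isOpen.mem_nhds hx)).differentiableAt (by simp)

theorem differentiableAt (h : IsLeviCivitaOn U G Γ) {x : E} (hx : x ∈ U) :
    DifferentiableAt ℝ Γ x :=
  (h.contDiffOn.contDiffAt (h.isOpen.mem_nhds hx)).differentiableAt (by simp)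

theorem fderiv_metric_symm (h : IsLeviCivitaOn U G Γ) {x : E} (hx : x ∈ U) (u v w : E) :
    fderiv ℝ G x u v w = fderiv ℝ G x u w v := by
  have hd := (h.metric_differentiableAt hx).hasFDerivAt
  have key (v w : E) := (hd.clm_apply (hasFDerivAt_const v x)).clm_apply (hasFDerivAt_const w x)
  have he : (fun y => G y v w) =ᶠ[nhds x] fun y => G y w v := by
    filter_upwards [h.isOpen.mem_nhds hx] with y hy using h.metric_symm y hy v w
  have := (key v w).unique ((key w v).congr_of_eventuallyEq he)
  simpa using DFunLike.congr_fun this u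

theorem symm (h : IsLeviCivitaOn U G Γ) {x : E} (hx : x ∈ U) (u v : E) : Γ x u v = Γ x v u := by
  rw [← sub_eq_zero]
  refine h.nondegenerate x hx _ fun w => ?_
  rw [map_sub, sub_apply, h.koszul x hx, h.koszul x hx,
    h.fderiv_metric_symm hx u w v, h.fderiv_metric_symm hx w u v, h.fderiv_metric_symm hx v u w]
  ring

/-- The Levi-Civita connection is compatible with the metric. -/
theorem fderiv_metric (h : IsLeviCivitaOn U G Γ) {x : E} (hx : x ∈ U) (u v w : E) :
    fderiv ℝ G x u v w = G x (Γ x u v) w + G x v (Γ x u w) := by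
  rw [h.metric_symm x hx v, h.koszul x hx, h.koszul x hx,
    h.fderiv_metric_symm hx u w v, h.fderiv_metric_symm hx w u v, h.fderiv_metric_symm hx v u w]
  ring

/-- Each `R(u, v)` is skew-adjoint: differentiate the compatibility of `Γ` with `G` once more and
use that second derivatives of `G` commute. -/
theorem metric_curvatureForm (h : IsLeviCivitaOn U G Γ) {x : E} (hx : x ∈ U) (u v a b : E) :
    G x (curvatureForm Γ x u v a) b = - G x a (curvatureForm Γ x u v b) := by
  have hG := (h.metric_contDiffOn.contDiffAt (h.isOpen.mem_nhds hx))
  have hG' := (h.metric_differentiableAt hx).hasFDerivAt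
  have hΓ := (h.differentiableAt hx).hasFDerivAt
  have hGG : HasFDerivAt (fderiv ℝ G) (fderiv ℝ (fderiv ℝ G) x) x :=
    ((hG.fderiv_right (m := 1) (by norm_cast)).differentiableAt (by simp)).hasFDerivAt
  have hsymm : ∀ u v, fderiv ℝ (fderiv ℝ G) x u v = fderiv ℝ (fderiv ℝ G) x v u :=
    fun u v => (hG.isSymmSndFDerivAt (by simp; norm_cast)).eq u v
  -- the derivative, in the direction `u`, of `D_v G (a, b) = G (Γ(v, a), b) + G (a, Γ(v, b))`
  have key (u v : E) : fderiv ℝ (fderiv ℝ G) x u v a b =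
      fderiv ℝ G x u (Γ x v a) b + G x (fderiv ℝ Γ x u v a) b
        + (fderiv ℝ G x u a (Γ x v b) + G x a (fderiv ℝ Γ x u v b)) := by
    have hl : HasFDerivAt (fun y => fderiv ℝ G y v a b) _ x :=
      ((hGG.clm_apply (hasFDerivAt_const v x)).clm_apply (hasFDerivAt_const a x)).clm_apply
        (hasFDerivAt_const b x)
    have hva (a : E) := (hΓ.clm_apply (hasFDerivAt_const v x)).clm_apply (hasFDerivAt_const a x)
    have hr : HasFDerivAt (fun y => G y (Γ y v a) b + G y a (Γ y v b)) _ x :=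
      ((hG'.clm_apply (hva a)).clm_apply (hasFDerivAt_const b x)).add
        ((hG'.clm_apply (hasFDerivAt_const a x)).clm_apply (hva b))
    have he : (fun y => fderiv ℝ G y v a b) =ᶠ[nhds x]
        fun y => G y (Γ y v a) b + G y a (Γ y v b) := by
      filter_upwards [h.isOpen.mem_nhds hx] with y hy using h.fderiv_metric hy v a b
    have := DFunLike.congr_fun (hl.unique (hr.congr_of_eventuallyEq he)) u
    simp at this
    linarith
  have h1 := key u v
  have h2 := key v u
  rw [hsymm u v, h2] at h1
  simp only [h.fderiv_metric hx] at h1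
  simp only [curvatureForm, map_add, map_sub, add_apply,
    sub_apply]
  linarith

end IsLeviCivitaOn

/-! ### Hessian of a map between spaces with a connection -/

section Map

variable {U : Set E} {G : E → E →L[ℝ] E →L[ℝ] ℝ} {Γ : E → E →L[ℝ] E →L[ℝ] E}
  {V : Set F} {H : F → F →L[ℝ] F →L[ℝ] ℝ} {γ : F → F →L[ℝ] F →L[ℝ] F} {f : F → E}

/-- The second covariant derivative `∇df(u, v)` of a map `f` between spaces carrying the
connections `γ` (source) and `Γ` (target). For an isometric immersion this is the second fundamental
form; for a change of coordinates its vanishing is the transformation law of the connection. -/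
def hessianForm (Γ : E → E →L[ℝ] E →L[ℝ] E) (γ : F → F →L[ℝ] F →L[ℝ] F) (f : F → E)
    (y u v : F) : E :=
  fderiv ℝ (fderiv ℝ f) y u v + Γ (f y) (fderiv ℝ f y u) (fderiv ℝ f y v) - fderiv ℝ f y (γ y u v)

theorem hasFDerivAt_fderiv {y : F} (hf : ContDiffAt ℝ ∞ f y) :
    HasFDerivAt (fderiv ℝ f) (fderiv ℝ (fderiv ℝ f) y) y :=
  ((hf.fderiv_right (m := 1) (by norm_cast)).differentiableAt (by simp)).hasFDerivAt

theorem fderiv_fderiv_symm {y : F} (hf : ContDiffAt ℝ ∞ f y) (u v : F) :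
    fderiv ℝ (fderiv ℝ f) y u v = fderiv ℝ (fderiv ℝ f) y v u :=
  (hf.isSymmSndFDerivAt (by simp; norm_cast)).eq u v

/-- The Hessian of an isometric immersion is normal to the image. This follows by differentiating
`H = f^* G` and comparing the two Koszul formulas. -/
theorem metric_hessianForm (hG : IsLeviCivitaOn U G Γ) (hH : IsLeviCivitaOn V H γ) {y : F}
    (hy : y ∈ V) (hfy : f y ∈ U) (hf : ContDiffAt ℝ ∞ f y)
    (hpull : ∀ᶠ z in nhds y, ∀ u v, H z u v = G (f z) (fderiv ℝ f z u) (fderiv ℝ f z v))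
    (u v w : F) : G (f y) (hessianForm Γ γ f y u v) (fderiv ℝ f y w) = 0 := by
  have hf' := (hf.differentiableAt (by simp)).hasFDerivAt
  have hff := hasFDerivAt_fderiv hf
  have key (w u v : F) : fderiv ℝ H y w u v =
      fderiv ℝ G (f y) (fderiv ℝ f y w) (fderiv ℝ f y u) (fderiv ℝ f y v)
      + G (f y) (fderiv ℝ (fderiv ℝ f) y w u) (fderiv ℝ f y v)
      + G (f y) (fderiv ℝ f y u) (fderiv ℝ (fderiv ℝ f) y w v) := by
    have hl : HasFDerivAt (fun z => H z u v) _ y :=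
      ((hH.metric_differentiableAt hy).hasFDerivAt.clm_apply (hasFDerivAt_const u y)).clm_apply
        (hasFDerivAt_const v y)
    have hu (u : F) := hff.clm_apply (hasFDerivAt_const u y)
    have hr : HasFDerivAt (fun z => G (f z) (fderiv ℝ f z u) (fderiv ℝ f z v)) _ y :=
      (((hG.metric_differentiableAt hfy).hasFDerivAt.comp y hf').clm_apply (hu u)).clm_apply (hu v)
    have he : (fun z => H z u v) =ᶠ[nhds y]
        fun z => G (f z) (fderiv ℝ f z u) (fderiv ℝ f z v) := by
      filter_upwards [hpull] with z hz using hz u v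
    have := DFunLike.congr_fun (hl.unique (hr.congr_of_eventuallyEq he)) w
    simp at this
    linarith
  have hk := hH.koszul y hy u v w
  rw [hpull.self_of_nhds] at hk
  simp only [hessianForm, map_add, map_sub, add_apply,
    sub_apply, hG.koszul _ hfy, hk, key]
  rw [fderiv_fderiv_symm hf v u, fderiv_fderiv_symm hf w u, fderiv_fderiv_symm hf w v,
    hG.metric_symm _ hfy (fderiv ℝ f y w)]
  ring

/-- A map with vanishing Hessian intertwines the curvatures: the equation `∇df = 0` is
differentiated and skew-symmetrized, which removes the third derivatives of `f`. -/
theorem curvatureForm_map (hG : IsLeviCivitaOn U G Γ) (hH : IsLeviCivitaOn V H γ) {y : F}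
    (hy : y ∈ V) (hfy : f y ∈ U) (hf : ContDiffAt ℝ ∞ f y)
    (hgeo : ∀ᶠ z in nhds y, ∀ u v, hessianForm Γ γ f z u v = 0) (u v w : F) :
    curvatureForm Γ (f y) (fderiv ℝ f y u) (fderiv ℝ f y v) (fderiv ℝ f y w)
      = fderiv ℝ f y (curvatureForm γ y u v w) := by
  have hf' := (hf.differentiableAt (by simp)).hasFDerivAt
  have hff := hasFDerivAt_fderiv hf
  have hfff : ContDiffAt ℝ ∞ (fderiv ℝ f) y := hf.fderiv_right (by norm_cast)
  have hess (u v : F) : fderiv ℝ (fderiv ℝ f) y u v = fderiv ℝ f y (γ y u v)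
      - Γ (f y) (fderiv ℝ f y u) (fderiv ℝ f y v) := by
    have := hgeo.self_of_nhds u v
    rw [hessianForm, sub_eq_zero] at this
    rw [← this]; abel
  -- the derivative, in the direction `u`, of `D²f(v, w) + Γ(Df v, Df w) = Df γ(v, w)`
  have key (u v : F) : fderiv ℝ (fderiv ℝ (fderiv ℝ f)) y u v w
      + (fderiv ℝ Γ (f y) (fderiv ℝ f y u) (fderiv ℝ f y v) (fderiv ℝ f y w)
      + Γ (f y) (fderiv ℝ (fderiv ℝ f) y u v) (fderiv ℝ f y w)
      + Γ (f y) (fderiv ℝ f y v) (fderiv ℝ (fderiv ℝ f) y u w))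
      = fderiv ℝ (fderiv ℝ f) y u (γ y v w) + fderiv ℝ f y (fderiv ℝ γ y u v w) := by
    have h1 := ((hasFDerivAt_fderiv hfff).clm_apply (hasFDerivAt_const v y)).clm_apply
      (hasFDerivAt_const w y)
    have hu (u : F) := hff.clm_apply (hasFDerivAt_const u y)
    have hΓ : HasFDerivAt (fun z => Γ (f z)) _ y :=
      (hG.differentiableAt hfy).hasFDerivAt.comp y hf'
    have h2 := (hΓ.clm_apply (hu v)).clm_apply (hu w)
    have h3 := hff.clm_apply (((hH.differentiableAt hy).hasFDerivAt.clm_apply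
      (hasFDerivAt_const v y)).clm_apply (hasFDerivAt_const w y))
    have he : (fun z => fderiv ℝ (fderiv ℝ f) z v w
        + Γ (f z) (fderiv ℝ f z v) (fderiv ℝ f z w)) =ᶠ[nhds y]
        fun z => fderiv ℝ f z (γ z v w) := by
      filter_upwards [hgeo] with z hz
      exact sub_eq_zero.1 (hz v w)
    have := DFunLike.congr_fun ((h1.add h2).unique (h3.congr_of_eventuallyEq he)) u
    simp at this
    rw [add_comm (fderiv ℝ (fderiv ℝ f) y u (γ y v w)), ← this]
    abel
  have h1 := key u v
  have h2 := key v u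
  rw [fderiv_fderiv_symm hfff v u] at h2
  have h3 : ∀ a b c d a' b' c' d' e : E, e + a = b → e + a' = b' → a - a' = b - b' := by
    intros; subst_vars; abel
  have h4 := h3 _ _ 0 0 _ _ 0 0 _ h1 h2
  simp only [hess, map_sub, sub_apply, hH.symm hy v u,
    hG.symm hfy (fderiv ℝ f y v) (fderiv ℝ f y u)] at h4
  simp only [curvatureForm, map_add, map_sub]
  rw [← sub_eq_zero] at h4 ⊢
  rw [← h4]
  abel

end Map
end Calculus

/-! ### Metric traces, Ricci and scalar curvature at a point -/

section Trace

variable {m n : ℕ}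

theorem eq_sum_single (v : EuclideanSpace ℝ (Fin n)) :
    v = ∑ i, v i • EuclideanSpace.single i (1 : ℝ) := by
  ext k
  simp [Pi.single_apply]

theorem bilin_eq_sum (B : EuclideanSpace ℝ (Fin n) →ₗ[ℝ] EuclideanSpace ℝ (Fin n) →ₗ[ℝ] ℝ)
    (u v : EuclideanSpace ℝ (Fin n)) :
    B u v = ∑ i, ∑ j,
      u i * v j * B (EuclideanSpace.single i 1) (EuclideanSpace.single j 1) := by
  conv_lhs => rw [eq_sum_single u, eq_sum_single v]
  simp only [map_sum, map_smul, LinearMap.sum_apply, LinearMap.smul_apply, smul_eq_mul,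
    Finset.mul_sum]
  rw [Finset.sum_comm]
  simp only [mul_assoc, mul_left_comm]

theorem clm_bilin_eq_sum
    (B : EuclideanSpace ℝ (Fin n) →L[ℝ] EuclideanSpace ℝ (Fin n) →L[ℝ] ℝ)
    (u v : EuclideanSpace ℝ (Fin n)) :
    B u v = ∑ i, ∑ j,
      u i * v j * B (EuclideanSpace.single i 1) (EuclideanSpace.single j 1) :=
  bilin_eq_sum B.toLinearMap₁₂ u v

/-- The matrix of a bilinear form in the standard basis. -/
def gram (B : EuclideanSpace ℝ (Fin n) →L[ℝ] EuclideanSpace ℝ (Fin n) →L[ℝ] ℝ) :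
    Matrix (Fin n) (Fin n) ℝ :=
  Matrix.of fun i j => B (EuclideanSpace.single i 1) (EuclideanSpace.single j 1)

theorem gram_det_ne_zero
    (B : EuclideanSpace ℝ (Fin n) →L[ℝ] EuclideanSpace ℝ (Fin n) →L[ℝ] ℝ)
    (h : ∀ u, (∀ v, B u v = 0) → u = 0) : (gram B).det ≠ 0 := by
  intro h0
  obtain ⟨v, hv, hv0⟩ := Matrix.exists_vecMul_eq_zero_iff.2 h0
  apply hv
  have : WithLp.toLp 2 v = (0 : EuclideanSpace ℝ (Fin n)) := by
    refine h _ fun w => ?_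
    rw [clm_bilin_eq_sum, Finset.sum_comm]
    refine Finset.sum_eq_zero fun j _ => ?_
    have := congrFun hv0 j
    simp only [Matrix.vecMul, dotProduct, gram, Matrix.of_apply, Pi.zero_apply] at this
    calc _ = w j * ∑ i, v i * B (EuclideanSpace.single i 1) (EuclideanSpace.single j 1) := by
            rw [Finset.mul_sum]; exact Finset.sum_congr rfl fun i _ => by ring
      _ = 0 := by rw [this, mul_zero]
  simpa using congrArg WithLp.ofLp this

/-- The metric trace of a bilinear form `B` may be computed in any frame `b`, with `J` the inverse
of the Gram matrix of that frame; this says that `Gⁱʲ = ∑ J s t * (b s)ⁱ (b t)ʲ`. -/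
theorem trace_frame {κ : Type*} [Fintype κ] [DecidableEq κ] (hκ : Fintype.card κ = n)
    (G : EuclideanSpace ℝ (Fin n) →L[ℝ] EuclideanSpace ℝ (Fin n) →L[ℝ] ℝ)
    (b : κ → EuclideanSpace ℝ (Fin n)) (J : Matrix κ κ ℝ)
    (hJ : J * Matrix.of (fun s t => G (b s) (b t)) = 1)
    (B : EuclideanSpace ℝ (Fin n) →ₗ[ℝ] EuclideanSpace ℝ (Fin n) →ₗ[ℝ] ℝ) :
    ∑ i, ∑ j, (gram G)⁻¹ i j * B (EuclideanSpace.single i 1) (EuclideanSpace.single j 1)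
      = ∑ s, ∑ t, J s t * B (b s) (b t) := by
  let Q : Matrix (Fin n) κ ℝ := Matrix.of fun i s => b s i
  have hQ : Matrix.of (fun s t => G (b s) (b t)) = Q.transpose * gram G * Q := by
    ext s t
    simp only [Matrix.of_apply, clm_bilin_eq_sum G (b s) (b t), Matrix.mul_apply,
      Matrix.transpose_apply, gram, Q, Finset.sum_mul]
    rw [Finset.sum_comm]
    exact Finset.sum_congr rfl fun i _ => Finset.sum_congr rfl fun j _ => by ring
  -- `J Qᵀ G` is a left inverse of the square matrix `Q`, hence a right inverse as well
  have h1 : (J * Q.transpose * gram G) * Q = 1 := by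
    rw [← hJ, hQ]; simp only [Matrix.mul_assoc]
  have h2 : Q * (J * Q.transpose * gram G) = 1 :=
    (Matrix.mul_eq_one_comm_of_card_eq _ _ _ (by simp [hκ])).1 h1
  have h3 : (gram G)⁻¹ = Q * J * Q.transpose :=
    Matrix.inv_eq_left_inv (by simpa only [Matrix.mul_assoc] using h2)
  simp only [h3, bilin_eq_sum B (b _) (b _), Matrix.mul_apply, Matrix.transpose_apply, Q,
    Matrix.of_apply, Finset.sum_mul, Finset.mul_sum]
  calc _ = ∑ i, ∑ s, ∑ t, ∑ j, b s i * J s t * b t j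
            * B (EuclideanSpace.single i 1) (EuclideanSpace.single j 1) := by
        refine Finset.sum_congr rfl fun i _ => ?_
        rw [Finset.sum_comm]
        conv_rhs => rw [Finset.sum_comm]
        refine Finset.sum_congr rfl fun t _ => ?_
        rw [Finset.sum_comm]
    _ = _ := by
        rw [Finset.sum_comm]
        refine Finset.sum_congr rfl fun s _ => ?_
        rw [Finset.sum_comm]
        refine Finset.sum_congr rfl fun t _ => Finset.sum_congr rfl fun i _ =>
          Finset.sum_congr rfl fun j _ => by ring

/-- A field of bilinear maps on `ℝⁿ`: the Christoffel symbols of a connection. -/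
abbrev ConnectionForm (n : ℕ) : Type :=
  EuclideanSpace ℝ (Fin n) →
    EuclideanSpace ℝ (Fin n) →L[ℝ] EuclideanSpace ℝ (Fin n) →L[ℝ] EuclideanSpace ℝ (Fin n)

/-- The Ricci form `Ric(u, v) = Tr (z ↦ R(z, v) u)` of the connection `Γ` at `x`. -/
def ricciForm (Γ : ConnectionForm n) (x : EuclideanSpace ℝ (Fin n)) :
    EuclideanSpace ℝ (Fin n) →ₗ[ℝ] EuclideanSpace ℝ (Fin n) →ₗ[ℝ] ℝ :=
  LinearMap.mk₂ ℝ (fun u v => ∑ s, curvatureForm Γ x (EuclideanSpace.single s 1) v u s)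
    (by intros; rw [← Finset.sum_add_distrib]; congr! 1; simp [curvatureForm]; ring)
    (by intros; rw [Finset.smul_sum]; congr! 1; simp [curvatureForm]; ring)
    (by intros; rw [← Finset.sum_add_distrib]; congr! 1; simp [curvatureForm]; ring)
    (by intros; rw [Finset.smul_sum]; congr! 1; simp [curvatureForm]; ring)

/-- The bilinear form `(z, w) ↦ G(w, R(z, v) u)`, whose metric trace is `Ric(u, v)`. -/
def curvaturePairing (G : EuclideanSpace ℝ (Fin n) →L[ℝ] EuclideanSpace ℝ (Fin n) →L[ℝ] ℝ)
    (Γ : ConnectionForm n) (x u v : EuclideanSpace ℝ (Fin n)) :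
    EuclideanSpace ℝ (Fin n) →ₗ[ℝ] EuclideanSpace ℝ (Fin n) →ₗ[ℝ] ℝ :=
  LinearMap.mk₂ ℝ (fun z w => G w (curvatureForm Γ x z v u))
    (by intros; simp [curvatureForm]; ring)
    (by intros; simp [curvatureForm]; ring)
    (by intros; simp) (by intros; simp)

theorem ricciForm_eq_trace
    (G : EuclideanSpace ℝ (Fin n) →L[ℝ] EuclideanSpace ℝ (Fin n) →L[ℝ] ℝ)
    (hG : (gram G).det ≠ 0) (Γ : ConnectionForm n) (x u v : EuclideanSpace ℝ (Fin n)) :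
    ricciForm Γ x u v = ∑ i, ∑ j, (gram G)⁻¹ i j * G (EuclideanSpace.single j 1)
      (curvatureForm Γ x (EuclideanSpace.single i 1) v u) := by
  have hinv := Matrix.nonsing_inv_mul (gram G) (isUnit_iff_ne_zero.2 hG)
  simp only [ricciForm, LinearMap.mk₂_apply]
  refine Finset.sum_congr rfl fun i _ => ?_
  set w := curvatureForm Γ x (EuclideanSpace.single i 1) v u
  have e (j : Fin n) : G (EuclideanSpace.single j 1) w = ∑ k, gram G j k * w k := by
    conv_lhs => rw [eq_sum_single w]
    simp [gram, mul_comm]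
  simp only [e, Finset.mul_sum]
  rw [Finset.sum_comm]
  simp only [← mul_assoc, ← Finset.sum_mul]
  have (k : Fin n) : ∑ j, (gram G)⁻¹ i j * gram G j k = (1 : Matrix (Fin n) (Fin n) ℝ) i k := by
    rw [← hinv, Matrix.mul_apply]
  simp [this, Matrix.one_apply]

theorem ricciForm_eq_frame {κ : Type*} [Fintype κ] [DecidableEq κ] (hκ : Fintype.card κ = n)
    (G : EuclideanSpace ℝ (Fin n) →L[ℝ] EuclideanSpace ℝ (Fin n) →L[ℝ] ℝ)
    (hG : (gram G).det ≠ 0)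
    (b : κ → EuclideanSpace ℝ (Fin n)) (J : Matrix κ κ ℝ)
    (hJ : J * Matrix.of (fun s t => G (b s) (b t)) = 1)
    (Γ : ConnectionForm n) (x u v : EuclideanSpace ℝ (Fin n)) :
    ricciForm Γ x u v = ∑ s, ∑ t, J s t * G (b t) (curvatureForm Γ x (b s) v u) :=
  (ricciForm_eq_trace G hG Γ x u v).trans
    (trace_frame hκ G b J hJ (curvaturePairing G Γ x u v))

/-- The scalar curvature, i.e. the metric trace of the Ricci form. -/
def scalarForm (G : EuclideanSpace ℝ (Fin n) →L[ℝ] EuclideanSpace ℝ (Fin n) →L[ℝ] ℝ)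
    (Γ : ConnectionForm n) (x : EuclideanSpace ℝ (Fin n)) : ℝ :=
  ∑ i, ∑ j, (gram G)⁻¹ i j *
    ricciForm Γ x (EuclideanSpace.single i 1) (EuclideanSpace.single j 1)

/-- The traced Gauss equation `R = R^S + 2 ε Ric(N, N)`: `L` embeds the tangent space of the
hypersurface, intertwining the metrics and the curvatures, and `N` is a unit normal. All traces are
taken in the frame formed by the image of the standard basis under `L` and by `N`. Only the
skew-symmetries of the curvature are used, not the Bianchi identity. -/
theorem scalarForm_hypersurface
    {G : EuclideanSpace ℝ (Fin (n + 1)) →L[ℝ] EuclideanSpace ℝ (Fin (n + 1)) →L[ℝ] ℝ}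
    {H : EuclideanSpace ℝ (Fin n) →L[ℝ] EuclideanSpace ℝ (Fin n) →L[ℝ] ℝ}
    (hG : (gram G).det ≠ 0) (hH : (gram H).det ≠ 0)
    (hGs : ∀ u v, G u v = G v u)
    {Γ : ConnectionForm (n + 1)} {γ : ConnectionForm n} {x : EuclideanSpace ℝ (Fin (n + 1))}
    {y : EuclideanSpace ℝ (Fin n)}
    (L : EuclideanSpace ℝ (Fin n) →L[ℝ] EuclideanSpace ℝ (Fin (n + 1)))
    (hL : ∀ u v, H u v = G (L u) (L v))
    (hskew : ∀ u v a b, G (curvatureForm Γ x u v a) b = - G a (curvatureForm Γ x u v b))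
    (hcurv : ∀ u v w, curvatureForm Γ x (L u) (L v) (L w) = L (curvatureForm γ y u v w))
    {N : EuclideanSpace ℝ (Fin (n + 1))} (hN : ∀ v, G N (L v) = 0)
    (hNN : G N N = 1 ∨ G N N = -1) :
    scalarForm G Γ x = scalarForm H γ y + 2 * G N N * ricciForm Γ x N N := by
  set ε := G N N with hε
  let e (i : Fin n) : EuclideanSpace ℝ (Fin n) := EuclideanSpace.single i 1
  let b : Fin n ⊕ Unit → EuclideanSpace ℝ (Fin (n + 1)) := Sum.elim (fun i => L (e i)) fun _ => N
  let J : Matrix (Fin n ⊕ Unit) (Fin n ⊕ Unit) ℝ :=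
    Matrix.fromBlocks (gram H)⁻¹ 0 0 (Matrix.of fun _ _ => ε)
  have hb : Matrix.of (fun s t => G (b s) (b t))
      = Matrix.fromBlocks (gram H) 0 0 (Matrix.of fun _ _ => ε) := by
    ext (i | i) (j | j)
    · simp [b, gram, hL, e]
    · simp [b, hGs _ N, hN]
    · simp [b, hN]
    · simp [b, ε]
  have hεε : ε * ε = 1 := by rcases hNN with h | h <;> rw [h] <;> norm_num
  have hJ : J * Matrix.of (fun s t => G (b s) (b t)) = 1 := by
    have h1 : (Matrix.of fun _ _ => ε : Matrix Unit Unit ℝ) * (Matrix.of fun _ _ => ε) = 1 := by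
      ext; simp [Matrix.mul_apply, hεε]
    rw [hb, Matrix.fromBlocks_multiply, Matrix.nonsing_inv_mul _ (isUnit_iff_ne_zero.2 hH)]
    simp [h1]
  have hinv (i j : Fin n) : (gram H)⁻¹ i j = (gram H)⁻¹ j i := by
    have ht : (gram H).transpose = gram H := by
      ext i j; simp [gram, hL, hGs (L (EuclideanSpace.single i 1))]
    conv_lhs => rw [← ht, ← Matrix.transpose_nonsing_inv]
    rfl
  have hκ : Fintype.card (Fin n ⊕ Unit) = n + 1 := by simp
  have hric (u v : EuclideanSpace ℝ (Fin (n + 1))) : ricciForm Γ x u v =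
      ∑ i, ∑ j, (gram H)⁻¹ i j * G (L (e j)) (curvatureForm Γ x (L (e i)) v u)
        + ε * G N (curvatureForm Γ x N v u) := by
    rw [ricciForm_eq_frame hκ G hG b J hJ]
    simp [Fintype.sum_sum_type, J, b]
  have hscal : scalarForm G Γ x = ∑ i, ∑ j, (gram H)⁻¹ i j * ricciForm Γ x (L (e i)) (L (e j))
      + ε * ricciForm Γ x N N := by
    rw [scalarForm, trace_frame hκ G b J hJ]
    simp [Fintype.sum_sum_type, J, b]
  have hself : curvatureForm Γ x N N N = 0 := by
    simp [curvatureForm]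
  have htan (i j : Fin n) : ricciForm Γ x (L (e i)) (L (e j)) = ricciForm γ y (e i) (e j)
      + ε * G (L (e i)) (curvatureForm Γ x (L (e j)) N N) := by
    -- `⟨N, R(N, Y) X⟩ = -⟨R(N, Y) N, X⟩ = ⟨X, R(Y, N) N⟩`
    have h1 : G N (curvatureForm Γ x N (L (e j)) (L (e i))) =
        G (L (e i)) (curvatureForm Γ x (L (e j)) N N) := by
      rw [curvatureForm_swap Γ x (L (e j)), map_neg, hGs (L (e i)), hskew, neg_neg]
    rw [hric, h1, ricciForm_eq_trace H hH]
    simp only [hcurv, hL, e]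
  have hnn : ricciForm Γ x N N =
      ∑ i, ∑ j, (gram H)⁻¹ i j * G (L (e i)) (curvatureForm Γ x (L (e j)) N N) := by
    rw [hric, hself, Finset.sum_comm]
    simp only [map_zero, mul_zero, add_zero]
    exact Finset.sum_congr rfl fun i _ => Finset.sum_congr rfl fun j _ => by rw [hinv]
  have hs : scalarForm G Γ x =
      scalarForm H γ y + ε * ricciForm Γ x N N + ε * ricciForm Γ x N N := by
    rw [hscal, hnn, scalarForm]
    simp only [htan, mul_add, Finset.sum_add_distrib, Finset.mul_sum, e]
    simp only [mul_left_comm]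
  rw [hs]; ring

end Trace

/-! ### Metric and connection of a pseudo-Riemannian manifold in a chart -/

section Charts

variable {n : ℕ} {M : Type*} [TopologicalSpace M] [ChartedSpace (EuclideanSpace ℝ (Fin n)) M]

/-- A smooth pseudo-Riemannian metric, of any signature, on an `n`-manifold. -/
structure IsPseudoMetric (g : BilinField n M) : Prop where
  smooth : ∀ φ ∈ atlas (EuclideanSpace ℝ (Fin n)) M, ∀ i j : Fin n,
    ContDiffOn ℝ ∞ (fun y => components g φ y i j) φ.target
  symm : ∀ (x : M) (X Y : TangentSpace (𝓡 n) x), g x X Y = g x Y X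
  nondegenerate : ∀ (x : M) (X : TangentSpace (𝓡 n) x), (∀ Y, g x X Y = 0) → X = 0

/-- The metric `g` read in the chart `φ`, as a field of bilinear forms on `ℝⁿ`. -/
def chartMetric (g : BilinField n M) (φ : OpenPartialHomeomorph M (EuclideanSpace ℝ (Fin n)))
    (y : EuclideanSpace ℝ (Fin n)) :
    EuclideanSpace ℝ (Fin n) →L[ℝ] EuclideanSpace ℝ (Fin n) →L[ℝ] ℝ :=
  LinearMap.toContinuousBilinearMap
    ((g (φ.symm y)).comp (mfderiv (𝓡 n) (𝓡 n) φ.symm y).toLinearMap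
      (mfderiv (𝓡 n) (𝓡 n) φ.symm y).toLinearMap :
        LinearMap.BilinForm ℝ (EuclideanSpace ℝ (Fin n)))

theorem chartMetric_apply (g : BilinField n M)
    (φ : OpenPartialHomeomorph M (EuclideanSpace ℝ (Fin n)))
    (y u v : EuclideanSpace ℝ (Fin n)) :
    chartMetric g φ y u v = g (φ.symm y) (mfderiv (𝓡 n) (𝓡 n) φ.symm y u)
      (mfderiv (𝓡 n) (𝓡 n) φ.symm y v) := rfl

theorem gram_chartMetric (g : BilinField n M)
    (φ : OpenPartialHomeomorph M (EuclideanSpace ℝ (Fin n))) (y : EuclideanSpace ℝ (Fin n)) :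
    gram (chartMetric g φ y) = components g φ y := rfl

theorem chartMetric_single (g : BilinField n M)
    (φ : OpenPartialHomeomorph M (EuclideanSpace ℝ (Fin n))) (y : EuclideanSpace ℝ (Fin n))
    (i j : Fin n) :
    chartMetric g φ y (EuclideanSpace.single i 1) (EuclideanSpace.single j 1)
      = components g φ y i j := rfl

/-- The Christoffel symbols of `g` in the chart `φ`, as a field of bilinear maps on `ℝⁿ`. -/
def chartChristoffel (g : BilinField n M)
    (φ : OpenPartialHomeomorph M (EuclideanSpace ℝ (Fin n))) : ConnectionForm n := fun y =>
  LinearMap.toContinuousBilinearMap (LinearMap.mk₂ ℝ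
    (fun u v => WithLp.toLp 2 fun l => ∑ i, ∑ j, christoffel g φ l i j y * u i * v j)
    (by intros; ext; simp only [PiLp.add_apply, ← Finset.sum_add_distrib]; congr! 2; ring)
    (by
      intros; ext; simp only [PiLp.smul_apply, smul_eq_mul, Finset.mul_sum]; congr! 2; ring)
    (by intros; ext; simp only [PiLp.add_apply, ← Finset.sum_add_distrib]; congr! 2; ring)
    (by
      intros; ext; simp only [PiLp.smul_apply, smul_eq_mul, Finset.mul_sum]; congr! 2; ring))

theorem chartChristoffel_apply (g : BilinField n M)
    (φ : OpenPartialHomeomorph M (EuclideanSpace ℝ (Fin n)))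
    (y u v : EuclideanSpace ℝ (Fin n)) (l : Fin n) :
    chartChristoffel g φ y u v l = ∑ i, ∑ j, christoffel g φ l i j y * u i * v j := rfl

theorem chartChristoffel_single (g : BilinField n M)
    (φ : OpenPartialHomeomorph M (EuclideanSpace ℝ (Fin n)))
    (y : EuclideanSpace ℝ (Fin n)) (l i j : Fin n) :
    chartChristoffel g φ y (EuclideanSpace.single i 1) (EuclideanSpace.single j 1) l
      = christoffel g φ l i j y := by
  simp [chartChristoffel_apply]

theorem contDiffOn_bilin {E W : Type*} [NormedAddCommGroup E] [NormedSpace ℝ E]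
    [NormedAddCommGroup W] [NormedSpace ℝ W] {U : Set E}
    {B : E → EuclideanSpace ℝ (Fin n) →L[ℝ] EuclideanSpace ℝ (Fin n) →L[ℝ] W}
    (h : ∀ i j, ContDiffOn ℝ ∞
      (fun y => B y (EuclideanSpace.single i 1) (EuclideanSpace.single j 1)) U) :
    ContDiffOn ℝ ∞ B U := by
  refine contDiffOn_clm_apply.2 fun u => contDiffOn_clm_apply.2 fun v => ?_
  have (y : E) : B y u v = ∑ i, ∑ j,
      u i • v j • B y (EuclideanSpace.single i 1) (EuclideanSpace.single j 1) := by
    conv_lhs => rw [eq_sum_single u, eq_sum_single v]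
    simp only [map_sum, map_smul, sum_apply, smul_apply, Finset.smul_sum]
    rw [Finset.sum_comm]
    exact Finset.sum_congr rfl fun i _ => Finset.sum_congr rfl fun j _ => smul_comm _ _ _
  simp only [this]
  exact ContDiffOn.sum fun i _ => ContDiffOn.sum fun j _ => ((h i j).const_smul _).const_smul _

theorem contDiffOn_det {ι E : Type*} [Fintype ι] [DecidableEq ι] [NormedAddCommGroup E]
    [NormedSpace ℝ E] {U : Set E} {A : E → Matrix ι ι ℝ}
    (h : ∀ i j, ContDiffOn ℝ ∞ (fun y => A y i j) U) :
    ContDiffOn ℝ ∞ (fun y => (A y).det) U := by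
  simp only [Matrix.det_apply]
  refine ContDiffOn.sum fun σ _ => ContDiffOn.const_smul _ ?_
  exact contDiffOn_prod fun i _ => h _ _

theorem contDiffOn_inv_apply {ι E : Type*} [Fintype ι] [DecidableEq ι] [NormedAddCommGroup E]
    [NormedSpace ℝ E] {U : Set E} {A : E → Matrix ι ι ℝ}
    (h : ∀ i j, ContDiffOn ℝ ∞ (fun y => A y i j) U) (h0 : ∀ y ∈ U, (A y).det ≠ 0) (i j : ι) :
    ContDiffOn ℝ ∞ (fun y => (A y)⁻¹ i j) U := by
  simp only [Matrix.inv_def, Matrix.smul_apply, smul_eq_mul, Matrix.adjugate_apply,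
    Ring.inverse_eq_inv']
  refine ((contDiffOn_det h).inv h0).mul (contDiffOn_det fun k l => ?_)
  by_cases hk : k = j
  · simp [Matrix.updateRow_apply, hk, contDiffOn_const]
  · simpa [Matrix.updateRow_apply, hk] using h k l

theorem trilinear_eq_zero {T : EuclideanSpace ℝ (Fin n) → EuclideanSpace ℝ (Fin n) →
      EuclideanSpace ℝ (Fin n) → ℝ}
    (h1 : ∀ v w, IsLinearMap ℝ fun u => T u v w) (h2 : ∀ u w, IsLinearMap ℝ fun v => T u v w)
    (h3 : ∀ u v, IsLinearMap ℝ fun w => T u v w)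
    (h : ∀ i j k, T (EuclideanSpace.single i 1) (EuclideanSpace.single j 1)
      (EuclideanSpace.single k 1) = 0) (u v w : EuclideanSpace ℝ (Fin n)) : T u v w = 0 := by
  have key {f : EuclideanSpace ℝ (Fin n) → ℝ} (hf : IsLinearMap ℝ f)
      (h0 : ∀ i, f (EuclideanSpace.single i 1) = 0) (u : EuclideanSpace ℝ (Fin n)) : f u = 0 := by
    change hf.mk' f u = 0
    rw [eq_sum_single u]
    simp [h0]
  exact key (h1 v w) (fun i => key (h2 _ w) (fun j => key (h3 _ _) (fun k => h i j k) w) v) u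

theorem IsPseudoMetric.chartMetric_contDiffOn {g : BilinField n M}
    {φ : OpenPartialHomeomorph M (EuclideanSpace ℝ (Fin n))} (hg : IsPseudoMetric g)
    (hφ : φ ∈ atlas (EuclideanSpace ℝ (Fin n)) M) :
    ContDiffOn ℝ ∞ (chartMetric g φ) φ.target :=
  contDiffOn_bilin fun i j => hg.smooth φ hφ i j

theorem IsPseudoMetric.partialDeriv_components {g : BilinField n M}
    {φ : OpenPartialHomeomorph M (EuclideanSpace ℝ (Fin n))} (hg : IsPseudoMetric g)
    (hφ : φ ∈ atlas (EuclideanSpace ℝ (Fin n)) M) {y : EuclideanSpace ℝ (Fin n)}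
    (hy : y ∈ φ.target) (i j k : Fin n) :
    partialDeriv (fun z => components g φ z i j) k y
      = fderiv ℝ (chartMetric g φ) y (EuclideanSpace.single k 1) (EuclideanSpace.single i 1)
        (EuclideanSpace.single j 1) := by
  have hd := (((hg.chartMetric_contDiffOn hφ).contDiffAt
    (φ.open_target.mem_nhds hy)).differentiableAt (by simp)).hasFDerivAt
  have : HasFDerivAt (fun z => components g φ z i j) _ y :=
    (hd.clm_apply (hasFDerivAt_const (EuclideanSpace.single i 1) y)).clm_apply
      (hasFDerivAt_const (EuclideanSpace.single j 1) y)
  rw [partialDeriv, this.fderiv]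
  simp

variable [IsManifold (𝓡 n) ∞ M] {g : BilinField n M}
  {φ : OpenPartialHomeomorph M (EuclideanSpace ℝ (Fin n))}

theorem mdifferentiable_chart_of_mem_atlas (hφ : φ ∈ atlas (EuclideanSpace ℝ (Fin n)) M) :
    φ.MDifferentiable (𝓡 n) (𝓡 n) :=
  haveI : IsManifold (𝓡 n) 1 M := IsManifold.of_le (n := ∞) (by norm_cast)
  mdifferentiable_of_mem_atlas hφ

namespace IsPseudoMetric

theorem chartMetric_nondegenerate (hg : IsPseudoMetric g)
    (hφ : φ ∈ atlas (EuclideanSpace ℝ (Fin n)) M) {y : EuclideanSpace ℝ (Fin n)}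
    (hy : y ∈ φ.target) (u : EuclideanSpace ℝ (Fin n)) (h : ∀ v, chartMetric g φ y u v = 0) :
    u = 0 := by
  have hd := (mdifferentiable_chart_of_mem_atlas hφ).symm
  have h0 : mfderiv (𝓡 n) (𝓡 n) φ.symm y u = 0 := by
    refine hg.nondegenerate _ _ fun Y => ?_
    obtain ⟨v, rfl⟩ := hd.mfderiv_surjective hy Y
    exact h v
  exact hd.mfderiv_injective hy (h0.trans (map_zero _).symm)

theorem components_det_ne_zero (hg : IsPseudoMetric g)
    (hφ : φ ∈ atlas (EuclideanSpace ℝ (Fin n)) M) {y : EuclideanSpace ℝ (Fin n)}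
    (hy : y ∈ φ.target) : (components g φ y).det ≠ 0 :=
  gram_det_ne_zero (chartMetric g φ y) (hg.chartMetric_nondegenerate hφ hy)

theorem contDiffOn_christoffel (hg : IsPseudoMetric g)
    (hφ : φ ∈ atlas (EuclideanSpace ℝ (Fin n)) M) (l i j : Fin n) :
    ContDiffOn ℝ ∞ (christoffel g φ l i j) φ.target := by
  have hp (i j k : Fin n) :
      ContDiffOn ℝ ∞ (partialDeriv (fun z => components g φ z i j) k) φ.target :=
    ((hg.smooth φ hφ i j).fderiv_of_isOpen φ.open_target (by norm_cast)).clm_apply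
      contDiffOn_const
  unfold christoffel
  exact contDiffOn_const.mul (ContDiffOn.sum fun m _ =>
    (contDiffOn_inv_apply (hg.smooth φ hφ) (fun y hy => hg.components_det_ne_zero hφ hy) l m).mul
      (((hp _ _ _).add (hp _ _ _)).sub (hp _ _ _)))

theorem chartChristoffel_contDiffOn (hg : IsPseudoMetric g)
    (hφ : φ ∈ atlas (EuclideanSpace ℝ (Fin n)) M) :
    ContDiffOn ℝ ∞ (chartChristoffel g φ) φ.target := by
  refine contDiffOn_bilin fun i j => contDiffOn_euclidean.2 fun l => ?_
  simp only [chartChristoffel_single]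
  exact hg.contDiffOn_christoffel hφ l i j

theorem partialDeriv_christoffel (hg : IsPseudoMetric g)
    (hφ : φ ∈ atlas (EuclideanSpace ℝ (Fin n)) M) {y : EuclideanSpace ℝ (Fin n)}
    (hy : y ∈ φ.target) (l i j k : Fin n) :
    partialDeriv (christoffel g φ l i j) k y
      = fderiv ℝ (chartChristoffel g φ) y (EuclideanSpace.single k 1) (EuclideanSpace.single i 1)
        (EuclideanSpace.single j 1) l := by
  have hd := (((hg.chartChristoffel_contDiffOn hφ).contDiffAt
    (φ.open_target.mem_nhds hy)).differentiableAt (by simp)).hasFDerivAt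
  have h1 := (hd.clm_apply (hasFDerivAt_const (EuclideanSpace.single i 1) y)).clm_apply
      (hasFDerivAt_const (EuclideanSpace.single j 1) y)
  have h2 : HasFDerivAt (christoffel g φ l i j) _ y :=
    ((EuclideanSpace.proj l : EuclideanSpace ℝ (Fin n) →L[ℝ] ℝ).hasFDerivAt.comp y
      h1).congr_of_eventuallyEq (Filter.Eventually.of_forall fun z =>
        (chartChristoffel_single g φ z l i j).symm)
  rw [partialDeriv, h2.fderiv]
  simp

/-- In a chart, the Christoffel symbols satisfy the Koszul formula: on basis vectors this is their
definition contracted with the metric. -/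
theorem isLeviCivitaOn (hg : IsPseudoMetric g) (hφ : φ ∈ atlas (EuclideanSpace ℝ (Fin n)) M) :
    IsLeviCivitaOn φ.target (chartMetric g φ) (chartChristoffel g φ) where
  isOpen := φ.open_target
  metric_contDiffOn := hg.chartMetric_contDiffOn hφ
  contDiffOn := hg.chartChristoffel_contDiffOn hφ
  metric_symm y _ u v := hg.symm _ _ _
  nondegenerate y hy u h := hg.chartMetric_nondegenerate hφ hy u h
  koszul y hy u v w := by
    have hs (k l : Fin n) : components g φ y k l = components g φ y l k := hg.symm _ _ _
    have hinv := Matrix.mul_nonsing_inv (components g φ y)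
      (isUnit_iff_ne_zero.2 (hg.components_det_ne_zero hφ hy))
    rw [← sub_eq_zero]
    refine trilinear_eq_zero (T := fun u v w => chartMetric g φ y (chartChristoffel g φ y u v) w
      - 1 / 2 * (fderiv ℝ (chartMetric g φ) y v u w + fderiv ℝ (chartMetric g φ) y u w v
        - fderiv ℝ (chartMetric g φ) y w u v)) ?_ ?_ ?_ ?_ u v w
    · exact fun v w => ⟨by intros; simp; ring, by intros; simp; ring⟩
    · exact fun v w => ⟨by intros; simp; ring, by intros; simp; ring⟩
    · exact fun v w => ⟨by intros; simp; ring, by intros; simp; ring⟩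
    intro i j k
    rw [sub_eq_zero]
    have e (a : EuclideanSpace ℝ (Fin n)) : chartMetric g φ y a (EuclideanSpace.single k 1)
        = ∑ l, components g φ y k l * a l := by
      conv_lhs => rw [eq_sum_single a]
      simp [chartMetric_single, hs k, mul_comm]
    have h1 (m : Fin n) : ∑ l, components g φ y k l * (components g φ y)⁻¹ l m
        = (1 : Matrix (Fin n) (Fin n) ℝ) k m := by
      rw [← hinv, Matrix.mul_apply]
    simp only [e, chartChristoffel_single, christoffel, Finset.mul_sum]
    rw [Finset.sum_comm]
    simp only [mul_left_comm _ (1 / 2 : ℝ), ← mul_assoc]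
    simp only [mul_assoc (1 / 2 : ℝ), ← Finset.mul_sum, ← Finset.sum_mul, h1]
    simp [Matrix.one_apply, hg.partialDeriv_components hφ hy]

theorem curvature_eq (hg : IsPseudoMetric g) (hφ : φ ∈ atlas (EuclideanSpace ℝ (Fin n)) M)
    {y : EuclideanSpace ℝ (Fin n)} (hy : y ∈ φ.target) (l k i j : Fin n) :
    curvature g φ l k i j y = curvatureForm (chartChristoffel g φ) y (EuclideanSpace.single i 1)
      (EuclideanSpace.single j 1) (EuclideanSpace.single k 1) l := by
  have e (i : Fin n) (a : EuclideanSpace ℝ (Fin n)) :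
      chartChristoffel g φ y (EuclideanSpace.single i 1) a l
        = ∑ r, a r * christoffel g φ l i r y := by
    simp [chartChristoffel_apply, mul_comm]
  simp only [curvature, curvatureForm, PiLp.add_apply, PiLp.sub_apply, e, chartChristoffel_single,
    hg.partialDeriv_christoffel hφ hy, Finset.sum_sub_distrib]

theorem ricciComponents_eq (hg : IsPseudoMetric g)
    (hφ : φ ∈ atlas (EuclideanSpace ℝ (Fin n)) M)
    {y : EuclideanSpace ℝ (Fin n)} (hy : y ∈ φ.target) (k j : Fin n) :
    ricciComponents g φ k j y = ricciForm (chartChristoffel g φ) y (EuclideanSpace.single k 1)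
      (EuclideanSpace.single j 1) := by
  simp only [ricciComponents, ricciForm, LinearMap.mk₂_apply, hg.curvature_eq hφ hy]

theorem scalarCurvature_eq (hg : IsPseudoMetric g) (x : M) :
    scalarCurvature g x = scalarForm
      (chartMetric g (chartAt (EuclideanSpace ℝ (Fin n)) x)
        (chartAt (EuclideanSpace ℝ (Fin n)) x x))
      (chartChristoffel g (chartAt (EuclideanSpace ℝ (Fin n)) x))
      (chartAt (EuclideanSpace ℝ (Fin n)) x x) := by
  simp only [scalarCurvature, scalarForm, gram_chartMetric,
    hg.ricciComponents_eq (chart_mem_atlas _ x) (mem_chart_target _ x)]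

theorem ricci_eq (hg : IsPseudoMetric g) (x : M) (X Y : TangentSpace (𝓡 n) x) :
    ricci g x X Y = ricciForm (chartChristoffel g (chartAt (EuclideanSpace ℝ (Fin n)) x))
      (chartAt (EuclideanSpace ℝ (Fin n)) x x)
      (mfderiv (𝓡 n) (𝓡 n) (chartAt (EuclideanSpace ℝ (Fin n)) x) x X)
      (mfderiv (𝓡 n) (𝓡 n) (chartAt (EuclideanSpace ℝ (Fin n)) x) x Y) := by
  refine Eq.trans ?_ (bilin_eq_sum _ _ _).symm
  simp only [ricci, hg.ricciComponents_eq (chart_mem_atlas _ x) (mem_chart_target _ x)]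
  exact Finset.sum_congr rfl fun i _ => Finset.sum_congr rfl fun j _ => by ring

end IsPseudoMetric

theorem chartMetric_mfderiv (g : BilinField n M) (hφ : φ ∈ atlas (EuclideanSpace ℝ (Fin n)) M)
    {x : M} (hx : x ∈ φ.source) (X Y : TangentSpace (𝓡 n) x) :
    chartMetric g φ (φ x) (mfderiv (𝓡 n) (𝓡 n) φ x X) (mfderiv (𝓡 n) (𝓡 n) φ x Y) = g x X Y := by
  have h := (mdifferentiable_chart_of_mem_atlas hφ).symm_comp_deriv hx
  have e (X : TangentSpace (𝓡 n) x) :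
      mfderiv (𝓡 n) (𝓡 n) φ.symm (φ x) (mfderiv (𝓡 n) (𝓡 n) φ x X) = X :=
    DFunLike.congr_fun h X
  -- `g p` and `g x` have different types, but all tangent spaces unfold to the model space
  have aux : ∀ p : M, p = x → ∀ u v : EuclideanSpace ℝ (Fin n),
      g p u v = g x u v := by rintro p rfl u v; rfl
  refine (chartMetric_apply _ _ _ _ _).trans ?_
  refine (aux _ (φ.left_inv hx) _ _).trans ?_
  exact congrArg₂ (fun u v => g x u v) (e X) (e Y)

end Charts

/-! ### Pullback of a metric, in charts -/

section Pullback

theorem eventually_mem_charts {X Y M S : Type*} [TopologicalSpace X] [TopologicalSpace Y]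
    [TopologicalSpace M] [TopologicalSpace S] {ι : S → M} {φ : OpenPartialHomeomorph M X}
    {ψ : OpenPartialHomeomorph S Y} (hι : Continuous ι) {y : Y} (hy : y ∈ ψ.target)
    (hφy : ι (ψ.symm y) ∈ φ.source) :
    ∀ᶠ z in nhds y, z ∈ ψ.target ∧ ι (ψ.symm z) ∈ φ.source :=
  Filter.Eventually.and (ψ.open_target.mem_nhds hy)
    ((hι.continuousAt.comp (ψ.symm.continuousAt hy)).preimage_mem_nhds
      (φ.open_source.mem_nhds hφy))

variable {m n : ℕ} {M : Type*} [TopologicalSpace M] [ChartedSpace (EuclideanSpace ℝ (Fin m)) M]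
  [IsManifold (𝓡 m) ∞ M]
  {S : Type*} [TopologicalSpace S] [ChartedSpace (EuclideanSpace ℝ (Fin n)) S]
  [IsManifold (𝓡 n) ∞ S] {ι : S → M}
  {φ : OpenPartialHomeomorph M (EuclideanSpace ℝ (Fin m))}
  {ψ : OpenPartialHomeomorph S (EuclideanSpace ℝ (Fin n))}

/-- The expression of `ι` in the charts `ψ` of the source and `φ` of the target. -/
def inCharts (ι : S → M) (φ : OpenPartialHomeomorph M (EuclideanSpace ℝ (Fin m)))
    (ψ : OpenPartialHomeomorph S (EuclideanSpace ℝ (Fin n))) (y : EuclideanSpace ℝ (Fin n)) :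
    EuclideanSpace ℝ (Fin m) := φ (ι (ψ.symm y))

theorem contDiffAt_inCharts (hι : ContMDiff (𝓡 n) (𝓡 m) ∞ ι)
    (hφ : φ ∈ atlas (EuclideanSpace ℝ (Fin m)) M) (hψ : ψ ∈ atlas (EuclideanSpace ℝ (Fin n)) S)
    {y : EuclideanSpace ℝ (Fin n)} (hy : y ∈ ψ.target) (hφy : ι (ψ.symm y) ∈ φ.source) :
    ContDiffAt ℝ ∞ (inCharts ι φ ψ) y := by
  have h1 := contMDiffAt_symm_of_mem_maximalAtlas (I := 𝓡 n) (n := ∞)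
    (IsManifold.subset_maximalAtlas hψ) hy
  have h2 := contMDiffAt_of_mem_maximalAtlas (I := 𝓡 m) (n := ∞)
    (IsManifold.subset_maximalAtlas hφ) hφy
  exact contMDiffAt_iff_contDiffAt.1 (h2.comp y ((hι _).comp y h1))

theorem fderiv_inCharts (hι : ContMDiff (𝓡 n) (𝓡 m) ∞ ι)
    (hφ : φ ∈ atlas (EuclideanSpace ℝ (Fin m)) M) (hψ : ψ ∈ atlas (EuclideanSpace ℝ (Fin n)) S)
    {y : EuclideanSpace ℝ (Fin n)} (hy : y ∈ ψ.target) {s : S} (hs : ψ.symm y = s)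
    (hφs : ι s ∈ φ.source) (u : EuclideanSpace ℝ (Fin n)) :
    fderiv ℝ (inCharts ι φ ψ) y u = mfderiv (𝓡 m) (𝓡 m) φ (ι s)
      (mfderiv (𝓡 n) (𝓡 m) ι s (mfderiv (𝓡 n) (𝓡 n) ψ.symm y u)) := by
  subst hs
  have h1 := ((mdifferentiable_chart_of_mem_atlas hψ).mdifferentiableAt_symm hy).hasMFDerivAt
  have h2 := ((mdifferentiable_chart_of_mem_atlas hφ).mdifferentiableAt hφs).hasMFDerivAt
  have h3 := ((hι (ψ.symm y)).mdifferentiableAt (by simp)).hasMFDerivAt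
  have h4 : mfderiv (𝓡 n) (𝓡 m) (inCharts ι φ ψ) y = _ := (h2.comp y (h3.comp y h1)).mfderiv
  rw [← mfderiv_eq_fderiv]
  exact DFunLike.congr_fun h4 u

theorem chartMetric_inCharts {g : BilinField m M} {h : BilinField n S}
    (hι : ContMDiff (𝓡 n) (𝓡 m) ∞ ι)
    (hh : ∀ s (v w : TangentSpace (𝓡 n) s), h s v w =
      g (ι s) (mfderiv (𝓡 n) (𝓡 m) ι s v) (mfderiv (𝓡 n) (𝓡 m) ι s w))
    (hφ : φ ∈ atlas (EuclideanSpace ℝ (Fin m)) M) (hψ : ψ ∈ atlas (EuclideanSpace ℝ (Fin n)) S)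
    {y : EuclideanSpace ℝ (Fin n)} (hy : y ∈ ψ.target) (hφy : ι (ψ.symm y) ∈ φ.source)
    (u v : EuclideanSpace ℝ (Fin n)) :
    chartMetric h ψ y u v = chartMetric g φ (inCharts ι φ ψ y)
      (fderiv ℝ (inCharts ι φ ψ) y u) (fderiv ℝ (inCharts ι φ ψ) y v) := by
  rw [fderiv_inCharts hι hφ hψ hy rfl hφy, fderiv_inCharts hι hφ hψ hy rfl hφy]
  refine Eq.trans ?_ (chartMetric_mfderiv g hφ hφy _ _).symm
  exact hh _ _ _

/-- The pullback of a metric by a smooth map is smooth; it is a metric as soon as it is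
nondegenerate. -/
theorem isPseudoMetric_pullback {g : BilinField m M} {h : BilinField n S}
    (hg : IsPseudoMetric g) (hι : ContMDiff (𝓡 n) (𝓡 m) ∞ ι)
    (hh : ∀ s (v w : TangentSpace (𝓡 n) s), h s v w =
      g (ι s) (mfderiv (𝓡 n) (𝓡 m) ι s v) (mfderiv (𝓡 n) (𝓡 m) ι s w))
    (hnd : ∀ s (v : TangentSpace (𝓡 n) s), (∀ w, h s v w = 0) → v = 0) :
    IsPseudoMetric h where
  symm s v w := by rw [hh, hh, hg.symm]
  nondegenerate := hnd
  smooth ψ hψ i j y hy := by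
    set φ := chartAt (EuclideanSpace ℝ (Fin m)) (ι (ψ.symm y))
    have hφ : φ ∈ atlas (EuclideanSpace ℝ (Fin m)) M := chart_mem_atlas _ _
    have hφy : ι (ψ.symm y) ∈ φ.source := mem_chart_source _ _
    have hf := contDiffAt_inCharts hι hφ hψ hy hφy
    have hf' : ContDiffAt ℝ ∞ (fderiv ℝ (inCharts ι φ ψ)) y := hf.fderiv_right (by norm_cast)
    have hG : ContDiffAt ℝ ∞ (chartMetric g φ) (inCharts ι φ ψ y) :=
      (hg.chartMetric_contDiffOn hφ).contDiffAt (φ.open_target.mem_nhds (φ.map_source hφy))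
    have hc := ((hG.comp y hf).clm_apply
      (hf'.clm_apply (contDiffAt_const (c := EuclideanSpace.single i 1)))).clm_apply
      (hf'.clm_apply (contDiffAt_const (c := EuclideanSpace.single j 1)))
    refine (hc.congr_of_eventuallyEq ?_).contDiffWithinAt
    filter_upwards [eventually_mem_charts hι.continuous hy hφy] with z hz
    exact chartMetric_inCharts hι hh hφ hψ hz.1 hz.2 _ _

end Pullback

/-! ### Curves and the geodesic equation in a normed space -/

section Geodesics

variable {E F : Type*} [NormedAddCommGroup E] [NormedSpace ℝ E]
  [NormedAddCommGroup F] [NormedSpace ℝ F]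

theorem deriv_comp_curve {f : F → E} {y v : ℝ → F} {t : ℝ}
    (hf : ContDiffAt ℝ ∞ f (y t)) (hy : HasDerivAt y (v t) t) :
    deriv (fun s => f (y s)) t = fderiv ℝ f (y t) (v t) :=
  ((hf.differentiableAt (by simp)).hasFDerivAt.comp_hasDerivAt t hy).deriv

theorem deriv_deriv_comp_curve {f : F → E} {y v : ℝ → F} {t : ℝ} {a : F}
    (hf : ContDiffAt ℝ ∞ f (y t)) (hy : ∀ᶠ s in nhds t, HasDerivAt y (v s) s)
    (hv : HasDerivAt v a t) :
    deriv (deriv fun s => f (y s)) t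
      = fderiv ℝ (fderiv ℝ f) (y t) (v t) (v t) + fderiv ℝ f (y t) a := by
  have hyt := hy.self_of_nhds
  have hev : ∀ᶠ s in nhds t, ContDiffAt ℝ 1 f (y s) :=
    hyt.continuousAt.eventually ((hf.of_le (m := 1) (by norm_cast)).eventually (by simp))
  have he : deriv (fun s => f (y s)) =ᶠ[nhds t] fun s => fderiv ℝ f (y s) (v s) := by
    filter_upwards [hy, hev] with s h1 h2
    exact ((h2.differentiableAt (by simp)).hasFDerivAt.comp_hasDerivAt s h1).deriv
  rw [he.deriv_eq]
  have h1 : HasDerivAt (fun s => fderiv ℝ f (y s)) _ t :=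
    (hasFDerivAt_fderiv hf).comp_hasDerivAt t hyt
  exact (h1.clm_apply hv).deriv

/-- Local existence of geodesics with given initial position and velocity, from the
Picard–Lindelöf theorem for the geodesic spray `(x, v) ↦ (v, -Γ(x)(v, v))`. -/
theorem exists_geodesic_ode [CompleteSpace E] {U : Set E} (hU : IsOpen U)
    {Γ : E → E →L[ℝ] E →L[ℝ] E} (hΓ : ContDiffOn ℝ ∞ Γ U) {x₀ : E} (hx₀ : x₀ ∈ U) (v₀ : E) :
    ∃ ε > 0, ∃ y v : ℝ → E, y 0 = x₀ ∧ v 0 = v₀ ∧ ∀ t ∈ Set.Ioo (-ε) ε,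
      y t ∈ U ∧ HasDerivAt y (v t) t ∧ HasDerivAt v (-Γ (y t) (v t) (v t)) t := by
  have hΓ' : ContDiffAt ℝ 1 Γ x₀ :=
    (hΓ.contDiffAt (hU.mem_nhds hx₀)).of_le (by norm_cast)
  have hX : ContDiffAt ℝ 1 (fun p : E × E => (p.2, -Γ p.1 p.2 p.2)) (x₀, v₀) := by
    have h1 : ContDiffAt ℝ 1 (fun p : E × E => Γ p.1) (x₀, v₀) :=
      ContDiffAt.comp (x₀, v₀) (g := Γ) hΓ' contDiffAt_fst
    exact contDiffAt_snd.prodMk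
      ((h1.clm_apply contDiffAt_snd).clm_apply contDiffAt_snd).neg
  obtain ⟨α, hα0, ε, hε, hα⟩ :=
    hX.exists_forall_mem_closedBall_exists_eq_forall_mem_Ioo_hasDerivAt₀ 0
  have hc : ContinuousAt (fun t => (α t).1) 0 :=
    (hα 0 ⟨by linarith, by linarith⟩).continuousAt.fst
  have hUn : ∀ᶠ t in nhds (0 : ℝ), (α t).1 ∈ U :=
    hc.preimage_mem_nhds (hU.mem_nhds (by rw [hα0]; exact hx₀))
  obtain ⟨δ, hδ, hδU⟩ := Metric.eventually_nhds_iff.1 hUn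
  refine ⟨min ε δ, lt_min hε hδ, fun t => (α t).1, fun t => (α t).2, by simp [hα0],
    by simp [hα0], fun t ht => ?_⟩
  have ht1 : t ∈ Set.Ioo (0 - ε) (0 + ε) :=
    ⟨by have := min_le_left ε δ; linarith [ht.1], by have := min_le_left ε δ; linarith [ht.2]⟩
  have hd := hα t ht1
  refine ⟨hδU ?_, hd.fst, hd.snd⟩
  rw [Real.dist_eq, sub_zero, abs_lt]
  exact ⟨by have := min_le_right ε δ; linarith [ht.1], by have := min_le_right ε δ; linarith [ht.2]⟩

end Geodesics

/-! ### Geodesics of a manifold -/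

section GeodesicsOnManifolds

variable {n : ℕ} {S : Type*} [TopologicalSpace S] [ChartedSpace (EuclideanSpace ℝ (Fin n)) S]
  [IsManifold (𝓡 n) ∞ S] {h : BilinField n S}
  {ψ ψ' : OpenPartialHomeomorph S (EuclideanSpace ℝ (Fin n))}

/-- Transformation law of the Christoffel symbols. A change of coordinates is an isometry, so its
Hessian is normal to the image, which here is the whole space. -/
theorem hessianForm_transition (hh : IsPseudoMetric h)
    (hψ : ψ ∈ atlas (EuclideanSpace ℝ (Fin n)) S) (hψ' : ψ' ∈ atlas (EuclideanSpace ℝ (Fin n)) S)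
    {y : EuclideanSpace ℝ (Fin n)} (hy : y ∈ ψ.target) (hy' : ψ.symm y ∈ ψ'.source)
    (u v : EuclideanSpace ℝ (Fin n)) :
    hessianForm (chartChristoffel h ψ') (chartChristoffel h ψ) (inCharts id ψ' ψ) y u v = 0 := by
  have hid : ContMDiff (𝓡 n) (𝓡 n) ∞ (id : S → S) := contMDiff_id
  have hpull : ∀ s (v w : TangentSpace (𝓡 n) s), h s v w =
      h (id s) (mfderiv (𝓡 n) (𝓡 n) id s v) (mfderiv (𝓡 n) (𝓡 n) id s w) := by
    intro s v w
    rw [mfderiv_id]; rfl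
  have hLC := hh.isLeviCivitaOn hψ
  have hLC' := hh.isLeviCivitaOn hψ'
  have hfy : inCharts id ψ' ψ y ∈ ψ'.target := ψ'.map_source hy'
  refine hLC'.nondegenerate _ hfy _ fun w => ?_
  obtain ⟨w', rfl⟩ : ∃ w', fderiv ℝ (inCharts id ψ' ψ) y w' = w := by
    obtain ⟨a, ha⟩ := (mdifferentiable_chart_of_mem_atlas hψ').mfderiv_surjective hy' w
    obtain ⟨b, hb⟩ := (mdifferentiable_chart_of_mem_atlas hψ).symm.mfderiv_surjective hy a
    refine ⟨b, ?_⟩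
    refine (fderiv_inCharts hid hψ' hψ hy rfl hy' b).trans (Eq.trans ?_ ha)
    rw [← hb, mfderiv_id]; rfl
  refine metric_hessianForm hLC' hLC hy hfy (contDiffAt_inCharts hid hψ' hψ hy hy') ?_ u v w'
  filter_upwards [eventually_mem_charts continuous_id hy hy'] with z hz u v
  exact chartMetric_inCharts hid hpull hψ' hψ hz.1 hz.2 u v

/-- A solution of the geodesic equation in one chart satisfies it in every chart of the atlas. -/
theorem isGeodesic_of_ode (hh : IsPseudoMetric h)
    (hψ : ψ ∈ atlas (EuclideanSpace ℝ (Fin n)) S) {y v : ℝ → EuclideanSpace ℝ (Fin n)} {a b : ℝ}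
    (H : ∀ t ∈ Set.Ioo a b, y t ∈ ψ.target ∧ HasDerivAt y (v t) t ∧
      HasDerivAt v (-chartChristoffel h ψ (y t) (v t) (v t)) t) :
    IsGeodesic h (fun t => ψ.symm (y t)) a b := by
  constructor
  · have hyc : ContinuousOn y (Set.Ioo a b) :=
      fun t ht => (H t ht).2.1.continuousAt.continuousWithinAt
    have hvc : ContinuousOn v (Set.Ioo a b) :=
      fun t ht => (H t ht).2.2.continuousAt.continuousWithinAt
    have hv1 : ContDiffOn ℝ 1 v (Set.Ioo a b) := by
      rw [show (1 : ℕ∞ω) = 0 + 1 from rfl, contDiffOn_succ_iff_deriv_of_isOpen isOpen_Ioo]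
      refine ⟨fun t ht => (H t ht).2.2.differentiableAt.differentiableWithinAt, by simp, ?_⟩
      rw [contDiffOn_zero]
      have hΓ : ContinuousOn (fun t => chartChristoffel h ψ (y t)) (Set.Ioo a b) :=
        (hh.chartChristoffel_contDiffOn hψ).continuousOn.comp hyc fun t ht => (H t ht).1
      exact ((hΓ.clm_apply hvc).clm_apply hvc).neg.congr fun t ht => (H t ht).2.2.deriv
    have hy2 : ContDiffOn ℝ 2 y (Set.Ioo a b) := by
      rw [show (2 : ℕ∞ω) = 1 + 1 from by norm_num, contDiffOn_succ_iff_deriv_of_isOpen isOpen_Ioo]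
      exact ⟨fun t ht => (H t ht).2.1.differentiableAt.differentiableWithinAt, by simp,
        hv1.congr fun t ht => (H t ht).2.1.deriv⟩
    have h1 : ContMDiffOn (𝓡 n) (𝓡 n) 2 ψ.symm ψ.target :=
      (contMDiffOn_symm_of_mem_maximalAtlas (I := 𝓡 n) (n := ∞)
        (IsManifold.subset_maximalAtlas hψ)).of_le (by norm_cast)
    exact h1.comp hy2.contMDiffOn fun t ht => (H t ht).1
  · intro t ht ψ' hψ' hs i
    obtain ⟨hyt, hd, hdv⟩ := H t ht
    have hf := contDiffAt_inCharts (contMDiff_id (I := 𝓡 n) (n := ∞)) hψ' hψ hyt hs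
    have e1 := deriv_comp_curve hf hd
    have hy : ∀ᶠ s in nhds t, HasDerivAt y (v s) s := by
      filter_upwards [isOpen_Ioo.mem_nhds ht] with s hs using (H s hs).2.1
    have e2 := deriv_deriv_comp_curve hf hy hdv
    have e3 := hessianForm_transition hh hψ hψ' hyt hs (v t) (v t)
    have e4 : deriv (deriv fun s => inCharts id ψ' ψ (y s)) t
        + chartChristoffel h ψ' (inCharts id ψ' ψ (y t))
          (deriv (fun s => inCharts id ψ' ψ (y s)) t)
          (deriv (fun s => inCharts id ψ' ψ (y s)) t) = 0 := by
      rw [e1, e2, ← e3, hessianForm, map_neg]; abel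
    -- `inCharts id ψ' ψ (y t)` unfolds to `ψ' (ψ.symm (y t))`, and `chartChristoffel` to the sum
    -- over Christoffel symbols in the geodesic equation
    exact congrArg (fun z : EuclideanSpace ℝ (Fin n) => z i) e4

end GeodesicsOnManifolds

/-! ### Maps that preserve geodesics -/

section TotallyGeodesic

variable {m n : ℕ} {M : Type*} [TopologicalSpace M] [ChartedSpace (EuclideanSpace ℝ (Fin m)) M]
  [IsManifold (𝓡 m) ∞ M]
  {S : Type*} [TopologicalSpace S] [ChartedSpace (EuclideanSpace ℝ (Fin n)) S]
  [IsManifold (𝓡 n) ∞ S] {ι : S → M}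
  {φ : OpenPartialHomeomorph M (EuclideanSpace ℝ (Fin m))}
  {ψ : OpenPartialHomeomorph S (EuclideanSpace ℝ (Fin n))}

/-- A map that takes geodesics to geodesics has vanishing Hessian. On the diagonal this compares
the geodesic equations of a geodesic and of its image at the initial time; the general case follows
by polarization. -/
theorem hessianForm_eq_zero_of_geodesics {g : BilinField m M} {h : BilinField n S}
    (hg : IsPseudoMetric g) (hh : IsPseudoMetric h) (hι : ContMDiff (𝓡 n) (𝓡 m) ∞ ι)
    (hgeo : ∀ (γ : ℝ → S) (a b : ℝ), IsGeodesic h γ a b → IsGeodesic g (ι ∘ γ) a b)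
    (hφ : φ ∈ atlas (EuclideanSpace ℝ (Fin m)) M) (hψ : ψ ∈ atlas (EuclideanSpace ℝ (Fin n)) S)
    {y : EuclideanSpace ℝ (Fin n)} (hy : y ∈ ψ.target) (hφy : ι (ψ.symm y) ∈ φ.source)
    (u v : EuclideanSpace ℝ (Fin n)) :
    hessianForm (chartChristoffel g φ) (chartChristoffel h ψ) (inCharts ι φ ψ) y u v = 0 := by
  have hf := contDiffAt_inCharts hι hφ hψ hy hφy
  have hdiag (v : EuclideanSpace ℝ (Fin n)) :
      hessianForm (chartChristoffel g φ) (chartChristoffel h ψ) (inCharts ι φ ψ) y v v = 0 := by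
    obtain ⟨ε, hε, c, w, rfl, rfl, H⟩ :=
      exists_geodesic_ode ψ.open_target (hh.chartChristoffel_contDiffOn hψ) hy v
    have h0 : (0 : ℝ) ∈ Set.Ioo (-ε) ε := ⟨by linarith, hε⟩
    have e4 := (hgeo _ _ _ (isGeodesic_of_ode hh hψ H)).2 0 h0 φ hφ hφy
    have hc : ∀ᶠ s in nhds (0 : ℝ), HasDerivAt c (w s) s := by
      filter_upwards [isOpen_Ioo.mem_nhds h0] with s hs using (H s hs).2.1
    have e1 := deriv_comp_curve hf (H 0 h0).2.1
    have e2 := deriv_deriv_comp_curve hf hc (H 0 h0).2.2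
    have e5 : deriv (deriv fun s => inCharts ι φ ψ (c s)) 0
        + chartChristoffel g φ (inCharts ι φ ψ (c 0))
          (deriv (fun s => inCharts ι φ ψ (c s)) 0)
          (deriv (fun s => inCharts ι φ ψ (c s)) 0) = 0 := by
      ext i; exact e4 i
    rw [e1, e2, map_neg] at e5
    rw [hessianForm, ← e5]; abel
  have hsymm : hessianForm (chartChristoffel g φ) (chartChristoffel h ψ) (inCharts ι φ ψ) y v u
      = hessianForm (chartChristoffel g φ) (chartChristoffel h ψ) (inCharts ι φ ψ) y u v := by
    have hfy : inCharts ι φ ψ y ∈ φ.target := φ.map_source hφy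
    rw [hessianForm, hessianForm, fderiv_fderiv_symm hf v u,
      (hh.isLeviCivitaOn hψ).symm hy v u, (hg.isLeviCivitaOn hφ).symm hfy]
  have hadd : hessianForm (chartChristoffel g φ) (chartChristoffel h ψ) (inCharts ι φ ψ) y
        (u + v) (u + v)
      = hessianForm (chartChristoffel g φ) (chartChristoffel h ψ) (inCharts ι φ ψ) y u u
      + hessianForm (chartChristoffel g φ) (chartChristoffel h ψ) (inCharts ι φ ψ) y u v
      + hessianForm (chartChristoffel g φ) (chartChristoffel h ψ) (inCharts ι φ ψ) y v u
      + hessianForm (chartChristoffel g φ) (chartChristoffel h ψ) (inCharts ι φ ψ) y v v := by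
    simp only [hessianForm, map_add, add_apply]; abel
  rw [hdiag, hdiag, hdiag, hsymm, zero_add, add_zero, ← two_smul ℝ] at hadd
  exact (smul_eq_zero.1 hadd.symm).resolve_left two_ne_zero

end TotallyGeodesic

/-! ### Totally geodesic hypersurfaces -/

section Hypersurface

variable {n : ℕ} {M : Type*} [TopologicalSpace M]
  [ChartedSpace (EuclideanSpace ℝ (Fin (n + 1))) M] [IsManifold (𝓡 (n + 1)) ∞ M]
  {S : Type*} [TopologicalSpace S] [ChartedSpace (EuclideanSpace ℝ (Fin n)) S]
  [IsManifold (𝓡 n) ∞ S] {ι : S → M}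

/-- The scalar curvature `R` of the ambient manifold along a totally geodesic hypersurface:
`R = R^S + 2 ε Ric(N, N)`. -/
theorem scalarCurvature_totallyGeodesic {g : BilinField (n + 1) M} {h : BilinField n S}
    (hg : IsPseudoMetric g) (hh : IsPseudoMetric h) (hι : ContMDiff (𝓡 n) (𝓡 (n + 1)) ∞ ι)
    (hpull : ∀ s (v w : TangentSpace (𝓡 n) s), h s v w =
      g (ι s) (mfderiv (𝓡 n) (𝓡 (n + 1)) ι s v) (mfderiv (𝓡 n) (𝓡 (n + 1)) ι s w))
    (hgeo : ∀ (γ : ℝ → S) (a b : ℝ), IsGeodesic h γ a b → IsGeodesic g (ι ∘ γ) a b)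
    (s : S) (N : TangentSpace (𝓡 (n + 1)) (ι s))
    (hN : ∀ v : TangentSpace (𝓡 n) s, g (ι s) N (mfderiv (𝓡 n) (𝓡 (n + 1)) ι s v) = 0)
    (hNN : g (ι s) N N = 1 ∨ g (ι s) N N = -1) :
    scalarCurvature g (ι s) = scalarCurvature h s + 2 * g (ι s) N N * ricci g (ι s) N N := by
  set φ := chartAt (EuclideanSpace ℝ (Fin (n + 1))) (ι s) with hφdef
  set ψ := chartAt (EuclideanSpace ℝ (Fin n)) s with hψdef
  have hφ : φ ∈ atlas (EuclideanSpace ℝ (Fin (n + 1))) M := chart_mem_atlas _ _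
  have hψ : ψ ∈ atlas (EuclideanSpace ℝ (Fin n)) S := chart_mem_atlas _ _
  have hφs : ι s ∈ φ.source := mem_chart_source _ _
  have hy : ψ s ∈ ψ.target := mem_chart_target _ _
  have hsy : ψ.symm (ψ s) = s := ψ.left_inv (mem_chart_source _ _)
  have hφy : ι (ψ.symm (ψ s)) ∈ φ.source := by rwa [hsy]
  have hfy : inCharts ι φ ψ (ψ s) = φ (ι s) := by rw [inCharts, hsy]
  have hLg := hg.isLeviCivitaOn hφ
  have hx : φ (ι s) ∈ φ.target := φ.map_source hφs
  rw [hg.scalarCurvature_eq, hh.scalarCurvature_eq, hg.ricci_eq]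
  have key := scalarForm_hypersurface (G := chartMetric g φ (φ (ι s)))
    (H := chartMetric h ψ (ψ s)) (Γ := chartChristoffel g φ) (γ := chartChristoffel h ψ)
    (x := φ (ι s)) (y := ψ s)
    (hg.components_det_ne_zero hφ hx) (hh.components_det_ne_zero hψ hy)
    (hLg.metric_symm _ hx) (fderiv ℝ (inCharts ι φ ψ) (ψ s))
    (fun u v => by
      rw [chartMetric_inCharts hι hpull hφ hψ hy hφy, hfy])
    (hLg.metric_curvatureForm hx)
    (fun u v w => by
      rw [← hfy]
      refine curvatureForm_map hLg (hh.isLeviCivitaOn hψ) hy (φ.map_source hφy)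
        (contDiffAt_inCharts hι hφ hψ hy hφy) ?_ u v w
      filter_upwards [eventually_mem_charts hι.continuous hy hφy] with z hz u v
      exact hessianForm_eq_zero_of_geodesics hg hh hι hgeo hφ hψ hz.1 hz.2 u v)
    (N := mfderiv (𝓡 (n + 1)) (𝓡 (n + 1)) φ (ι s) N)
    (fun v => by
      rw [fderiv_inCharts hι hφ hψ hy hsy hφs]
      exact (chartMetric_mfderiv g hφ hφs _ _).trans (hN _))
    (by
      have := chartMetric_mfderiv g hφ hφs N N
      exact hNN.imp this.trans this.trans)
  have e := chartMetric_mfderiv g hφ hφs N N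
  exact key.trans (congrArg (fun r : ℝ => scalarForm (chartMetric h ψ (ψ s))
    (chartChristoffel h ψ) (ψ s) + 2 * r * ricciForm (chartChristoffel g φ) (φ (ι s))
      (mfderiv (𝓡 (n + 1)) (𝓡 (n + 1)) φ (ι s) N)
      (mfderiv (𝓡 (n + 1)) (𝓡 (n + 1)) φ (ι s) N)) e)

end Hypersurface

/-! ### Lorentz metrics and the field equations -/

theorem IsLorentzMetric.isPseudoMetric {M : Type*} [TopologicalSpace M]
    [ChartedSpace (EuclideanSpace ℝ (Fin 4)) M] {g : BilinField 4 M} (hg : IsLorentzMetric g) :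
    IsPseudoMetric g where
  smooth := hg.smooth
  symm := hg.symm
  nondegenerate x X hX := by
    obtain ⟨e, he⟩ := hg.signature x
    refine e.ext_elem fun j => ?_
    have h1 := hX (e j)
    rw [← e.sum_repr X] at h1
    simp only [map_sum, map_smul, LinearMap.sum_apply, LinearMap.smul_apply, smul_eq_mul, he,
      mul_ite, mul_zero, Finset.sum_ite_eq', Finset.mem_univ, if_true] at h1
    split_ifs at h1 <;> simpa using h1

end Spacetime
end

theorem mainTheorem2
    {M : Type*} [TopologicalSpace M] [T2Space M]
    [ChartedSpace (EuclideanSpace ℝ (Fin 4)) M] [IsManifold (𝓡 4) ∞ M]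
    {S : Type*} [TopologicalSpace S]
    [ChartedSpace (EuclideanSpace ℝ (Fin 3)) S] [IsManifold (𝓡 3) ∞ S]
    (g : Spacetime.BilinField 4 M) (hg : Spacetime.IsLorentzMetric g)
    (κ : ℝ) (𝓔 : Spacetime.BilinField 4 M)
    (hE : Spacetime.EinsteinFieldEquations g κ 𝓔)
    (ι : S → M) (hι : Manifold.IsSmoothEmbedding (𝓡 3) (𝓡 4) ∞ ι)
    (hnd : Spacetime.InducedNondegenerate g ι)
    (hgeo : Spacetime.IsTotallyGeodesic g ι) :
    (∀ (s : S) (N : TangentSpace (𝓡 4) (ι s)), Spacetime.IsUnitNormal g ι s N →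
      Spacetime.scalarCurvature (Spacetime.induced g ι) s
        = -16 * g (ι s) N N * Real.pi * κ * 𝓔 (ι s) N N) ∧
    (∀ c : ℝ, 0 < c → Spacetime.IsPerfectFluid g c 𝓔 → Spacetime.IsSpacelike g ι →
      ∀ (s : S) (N : TangentSpace (𝓡 4) (ι s)), Spacetime.IsUnitNormal g ι s N →
        Spacetime.scalarCurvature (Spacetime.induced g ι) s
          = 16 * Real.pi * κ * 𝓔 (ι s) N N) := by
  have hg' := hg.isPseudoMetric
  have hι' := hι.contMDiff
  have hpull : ∀ s (v w : TangentSpace (𝓡 3) s), Spacetime.induced g ι s v w =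
      g (ι s) (mfderiv (𝓡 3) (𝓡 4) ι s v) (mfderiv (𝓡 3) (𝓡 4) ι s w) := fun _ _ _ => rfl
  have hh := Spacetime.isPseudoMetric_pullback hg' hι' hpull hnd
  have part1 : ∀ (s : S) (N : TangentSpace (𝓡 4) (ι s)), Spacetime.IsUnitNormal g ι s N →
      Spacetime.scalarCurvature (Spacetime.induced g ι) s
        = -16 * g (ι s) N N * Real.pi * κ * 𝓔 (ι s) N N := by
    intro s N hN
    have hgauss := Spacetime.scalarCurvature_totallyGeodesic hg' hh hι' hpull hgeo s N hN.1 hN.2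
    have hein := hE (ι s) N N
    rw [Spacetime.einsteinTensor] at hein
    have hεε : g (ι s) N N * g (ι s) N N = 1 := by
      rcases hN.2 with h | h <;> rw [h] <;> norm_num
    -- `R^S = R - 2 ε Ric(N, N) = -2 ε G(N, N)`, as `ε² = 1`
    linear_combination (-1) * hgauss - 2 * g (ι s) N N * hein
      - Spacetime.scalarCurvature g (ι s) * hεε
  refine ⟨part1, fun c _ _ hsp s N hN => ?_⟩
  have hN0 : N ≠ 0 := by
    rintro rfl
    have := hN.2
    simp at this
  have hε : g (ι s) N N = -1 := by
    have hneg := hsp s N hN.1 hN0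
    exact hN.2.resolve_left (by linarith)
  rw [part1 s N hN, hε]
  ring
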